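/- Let $d\ge 1$ and let $\Omega\subset\mathbb R^d$ be a bounded $C^1$-domain, i.e. a bounded, connected open set such that near every boundary point, after a rigid motion, $\Omega$ is the region strictly below the graph of a $C^1$-function $\gamma:\mathbb R^{d-1}\to\mathbb R$; let $\vec n$ be its outward unit normal and $\sigma_{d-1}$ the surface measure on $\partial\Omega$ (the $(d-1)$-dimensional Hausdorff measure). For $\varepsilon\in(0,1)$ let $\alpha_\varepsilon,\mu_\varepsilon:\mathbb R^d\setminus\{0\}\to[0,\infty)$ be measurable radial functions such that $$\text{(L1)}\quad \int_{\mathbb R^d}\min\{1,|h|^2\}\,\alpha_\varepsilon(h)\mu_\varepsilon(h)\,dh=d\quad\text{for all }\varepsilon\in(0,1),$$ $$\text{(L2)}\quad \lim_{\varepsilon\to0^+}\int_{|h|>\delta}\alpha_\varepsilon(h)\mu_\varepsilon(h)\,dh=0\quad\text{for all }\delta>0.$$ Let $F\in C^1(\overline\Omega;\mathbb R^d)$, extended (in any way) to a compactly supported $C^1$ vector field on $\mathbb R^d$, again denoted by $F$. Put $f_\varepsilon(x,x)=0$, $$f_\varepsilon(x,y)=\alpha_\varepsilon(x-y)\int_0^1F\big(x+t(y-x)\big)\cdot(y-x)\,dt\quad(x\ne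 y),$$ $$\mathcal N_\varepsilon f_\varepsilon(x)=-2\int_\Omega f_\varepsilon(x,y)\,\mu_\varepsilon(y-x)\,dy\quad(x\in\Omega^c).$$ Then, for every $\varepsilon\in(0,1)$, the integral defining $\mathcal N_\varepsilon f_\varepsilon(x)$ converges absolutely for almost every $x\in\Omega^c$ and $\mathcal N_\varepsilon f_\varepsilon$ is integrable over $\Omega^c$; moreover $F\cdot\vec n$ is integrable over $\partial\Omega$, and $$\lim_{\varepsilon\to0^+}\int_{\Omega^c}\mathcal N_\varepsilon f_\varepsilon(x)\,dx=\int_{\partial\Omega}F(x)\cdot\vec n(x)\,d\sigma_{d-1}(x).$$ -/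

import Mathlib

open MeasureTheory Set Filter Topology

/-- A bounded `C¹`-domain in `ℝᵈ`, `d = n + 1`: a bounded, connected open set that, near each of its
boundary points and after a rigid motion `φ`, is the region strictly below the graph of a
`C¹`-function `γ : ℝᵈ⁻¹ → ℝ`. -/
def IsBoundedC1Domain {n : ℕ} (Ω : Set (EuclideanSpace ℝ (Fin (n + 1)))) : Prop :=
  IsOpen Ω ∧ IsConnected Ω ∧ Bornology.IsBounded Ω ∧
    ∀ z ∈ frontier Ω, ∃ r : ℝ, 0 < r ∧
      ∃ (φ : EuclideanSpace ℝ (Fin (n + 1)) ≃ᵃⁱ[ℝ] EuclideanSpace ℝ (Fin (n + 1)))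
        (γ : EuclideanSpace ℝ (Fin n) → ℝ), ContDiff ℝ 1 γ ∧
          ∀ x ∈ Metric.ball z r,
            (x ∈ Ω ↔ φ x (Fin.last n) < γ (WithLp.toLp 2 fun i : Fin n => φ x i.castSucc))

/-- `v` is the outward unit normal vector of `Ω` at the boundary point `z`: near `z`, the set `Ω` is
`{ρ < 0}` for a `C¹`-function `ρ` with `ρ z = 0` and `∇ρ z ≠ 0`, and `v = ∇ρ z / |∇ρ z|`. -/
def IsOutwardUnitNormal {d : ℕ} (Ω : Set (EuclideanSpace ℝ (Fin d)))
    (z v : EuclideanSpace ℝ (Fin d)) : Prop :=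
  ∃ ρ : EuclideanSpace ℝ (Fin d) → ℝ, ContDiffAt ℝ 1 ρ z ∧ ρ z = 0 ∧ gradient ρ z ≠ 0 ∧
    (∀ᶠ x in 𝓝 z, x ∈ Ω ↔ ρ x < 0) ∧ v = ‖gradient ρ z‖⁻¹ • gradient ρ z

open Classical in
/-- The outward unit normal field of `Ω` (with value `0` at points that have no normal; on the
boundary of a `C¹`-domain the normal exists and is unique, as shown below). -/
noncomputable def outwardNormal {d : ℕ} (Ω : Set (EuclideanSpace ℝ (Fin d)))
    (z : EuclideanSpace ℝ (Fin d)) : EuclideanSpace ℝ (Fin d) :=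
  if h : ∃ v, IsOutwardUnitNormal Ω z v then h.choose else 0

lemma hasDerivAt_along {d : ℕ} {ρ : EuclideanSpace ℝ (Fin d) → ℝ}
    {z : EuclideanSpace ℝ (Fin d)} (h : ContDiffAt ℝ 1 ρ z) (u : EuclideanSpace ℝ (Fin d)) :
    HasDerivAt (fun t : ℝ => ρ (z + t • u)) (inner ℝ (gradient ρ z) u) 0 := by
  have hg : HasFDerivAt ρ (InnerProductSpace.toDual ℝ _ (gradient ρ z)) (z + (0 : ℝ) • u) := by
    have := (h.differentiableAt one_ne_zero).hasGradientAt.hasFDerivAt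
    simpa using this
  have hl : HasDerivAt (fun t : ℝ => z + t • u) u 0 := by
    simpa using ((hasDerivAt_id (0 : ℝ)).smul_const u).const_add z
  have hc := hg.comp_hasDerivAt (0 : ℝ) hl
  rw [InnerProductSpace.toDual_apply_apply] at hc
  exact hc

/-- The outward unit normal vector at a point is unique. -/
theorem IsOutwardUnitNormal.unique {d : ℕ} {Ω : Set (EuclideanSpace ℝ (Fin d))}
    {z v w : EuclideanSpace ℝ (Fin d)} (hv : IsOutwardUnitNormal Ω z v)
    (hw : IsOutwardUnitNormal Ω z w) : v = w := by
  obtain ⟨ρ, hρ, hρ0, hρg, hρΩ, rfl⟩ := hv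
  obtain ⟨σ, hσ, hσ0, hσg, hσΩ, rfl⟩ := hw
  set a := gradient ρ z
  set b := gradient σ z
  by_contra hne
  have ha : 0 < ‖a‖ := norm_pos_iff.2 hρg
  have hb : 0 < ‖b‖ := norm_pos_iff.2 hσg
  set a' := ‖a‖⁻¹ • a with ha'
  set b' := ‖b‖⁻¹ • b with hb'
  have na : ‖a'‖ = 1 := by simp [ha', norm_smul, ha.ne']
  have nb : ‖b'‖ = 1 := by simp [hb', norm_smul, hb.ne']
  have hc : inner ℝ a' b' < 1 := (inner_lt_one_iff_real_of_norm_eq_one na nb).2 hne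
  have ea : a = ‖a‖ • a' := by simp [ha', smul_smul, ha.ne']
  have eb : b = ‖b‖ • b' := by simp [hb', smul_smul, hb.ne']
  have h1 : inner ℝ a (b' - a') < 0 := by
    rw [ea, real_inner_smul_left, inner_sub_right, real_inner_self_eq_norm_sq, na]
    nlinarith
  have h2 : 0 < inner ℝ b (b' - a') := by
    rw [eb, real_inner_smul_left, inner_sub_right, real_inner_self_eq_norm_sq, nb,
      real_inner_comm]
    exact mul_pos hb (by linarith)
  have d1 := hasDerivAt_along hρ (b' - a')
  have d2 := hasDerivAt_along hσ (b' - a')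
  have e1 : ∀ᶠ t in 𝓝[>] (0 : ℝ), ρ (z + t • (b' - a')) < 0 := by
    have := (hasDerivAt_iff_tendsto_slope.1 d1).eventually (gt_mem_nhds h1)
    have := this.filter_mono (nhdsWithin_mono (0 : ℝ) (fun x (hx : (0 : ℝ) < x) => hx.ne'))
    filter_upwards [this, self_mem_nhdsWithin] with t ht ht0
    have ht0 : 0 < t := ht0
    simp only [slope, vsub_eq_sub, sub_zero, zero_smul, add_zero, hρ0, smul_eq_mul] at ht
    by_contra hcon
    have : 0 ≤ t⁻¹ * ρ (z + t • (b' - a')) :=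
      mul_nonneg (inv_nonneg.2 ht0.le) (not_lt.1 hcon)
    linarith
  have e2 : ∀ᶠ t in 𝓝[>] (0 : ℝ), 0 < σ (z + t • (b' - a')) := by
    have := (hasDerivAt_iff_tendsto_slope.1 d2).eventually (lt_mem_nhds h2)
    have := this.filter_mono (nhdsWithin_mono (0 : ℝ) (fun x (hx : (0 : ℝ) < x) => hx.ne'))
    filter_upwards [this, self_mem_nhdsWithin] with t ht ht0
    have ht0 : 0 < t := ht0
    simp only [slope, vsub_eq_sub, sub_zero, zero_smul, add_zero, hσ0, smul_eq_mul] at ht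
    by_contra hcon
    have : t⁻¹ * σ (z + t • (b' - a')) ≤ 0 :=
      mul_nonpos_of_nonneg_of_nonpos (inv_nonneg.2 ht0.le) (not_lt.1 hcon)
    linarith
  have hl : Tendsto (fun t : ℝ => z + t • (b' - a')) (𝓝[>] 0) (𝓝 z) := by
    have : ContinuousAt (fun t : ℝ => z + t • (b' - a')) 0 := by fun_prop
    have h := this.tendsto
    simp only [zero_smul, add_zero] at h
    exact h.mono_left nhdsWithin_le_nhds
  obtain ⟨t, t1, t2, t3, t4⟩ :=
    (e1.and (e2.and ((hl.eventually hρΩ).and (hl.eventually hσΩ)))).exists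
  exact absurd (t4.1 (t3.2 t1)) (not_lt.2 t2.le)

/-- At a boundary point of a `C¹`-domain the outward unit normal vector exists. -/
theorem IsBoundedC1Domain.exists_normal {n : ℕ} {Ω : Set (EuclideanSpace ℝ (Fin (n + 1)))}
    (hΩ : IsBoundedC1Domain Ω) {z : EuclideanSpace ℝ (Fin (n + 1))} (hz : z ∈ frontier Ω) :
    ∃ v, IsOutwardUnitNormal Ω z v := by
  obtain ⟨r, hr, φ, γ, hγ, hx⟩ := hΩ.2.2.2 z hz
  set ρ : EuclideanSpace ℝ (Fin (n + 1)) → ℝ := fun x =>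
    φ x (Fin.last n) - γ (WithLp.toLp 2 fun i : Fin n => φ x i.castSucc) with hρdef
  have hφ : ContDiff ℝ 1 φ := φ.toContinuousAffineEquiv.toContinuousAffineMap.contDiff
  have hc : ∀ i, ContDiff ℝ 1 fun x => φ x i := fun i => contDiff_euclidean.1 hφ i
  have hρ : ContDiff ℝ 1 ρ := by
    refine (hc _).sub (hγ.comp ?_)
    rw [contDiff_euclidean]
    exact fun i => hc _
  have hev : ∀ᶠ x in 𝓝 z, x ∈ Ω ↔ ρ x < 0 := by
    filter_upwards [Metric.ball_mem_nhds z hr] with x hxb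
    rw [hx x hxb, hρdef]
    simp only [sub_neg]
  have hz1 : ¬ ρ z < 0 := by
    rw [← hev.self_of_nhds]
    have := hz.2
    rwa [hΩ.1.interior_eq] at this
  have hz2 : ¬ 0 < ρ z := by
    intro h
    have h1 : ∀ᶠ x in 𝓝 z, 0 < ρ x := hρ.continuous.continuousAt.eventually (lt_mem_nhds h)
    have h2 : ∃ᶠ x in 𝓝 z, x ∈ Ω := mem_closure_iff_frequently.1 hz.1
    obtain ⟨x, hxΩ, h3, h4⟩ := (h2.and_eventually (h1.and hev)).exists
    exact absurd (h4.1 hxΩ) (not_lt.2 h3.le)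
  refine ⟨_, ρ, hρ.contDiffAt, le_antisymm (not_lt.1 hz2) (not_lt.1 hz1), ?_, hev, rfl⟩
  intro hg
  set u := φ.linearIsometryEquiv.symm (EuclideanSpace.single (Fin.last n) (1 : ℝ)) with hu
  have hd := hasDerivAt_along (z := z) hρ.contDiffAt u
  rw [hg, inner_zero_left] at hd
  have hline : ∀ t : ℝ, φ (z + t • u) = φ z + t • EuclideanSpace.single (Fin.last n) (1 : ℝ) := by
    intro t
    have h := φ.map_vadd z (t • u)
    rw [vadd_eq_add, vadd_eq_add, map_smul, hu, LinearIsometryEquiv.apply_symm_apply] at h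
    rw [add_comm z, hu, h]
    exact add_comm _ _
  have hval : (fun t : ℝ => ρ (z + t • u)) = fun t => ρ z + t := by
    funext t
    simp only [hρdef, hline]
    simp [Fin.castSucc_ne_last]
    ring
  rw [hval] at hd
  have := hd.unique ((hasDerivAt_id (0 : ℝ)).const_add (ρ z))
  norm_num at this

theorem IsBoundedC1Domain.outwardNormal_spec {n : ℕ}
    {Ω : Set (EuclideanSpace ℝ (Fin (n + 1)))} (hΩ : IsBoundedC1Domain Ω)
    {z : EuclideanSpace ℝ (Fin (n + 1))} (hz : z ∈ frontier Ω) :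
    IsOutwardUnitNormal Ω z (outwardNormal Ω z) := by
  have h := hΩ.exists_normal hz
  rw [outwardNormal, dif_pos h]
  exact h.choose_spec

/-- A nonnegative, (Lebesgue) measurable, radial function on `ℝᵈ \ {0}`; the value at `0` plays no
role. -/
structure IsRadialKernel {d : ℕ} (k : EuclideanSpace ℝ (Fin d) → ℝ) : Prop where
  aemeasurable : AEMeasurable k volume
  nonneg : ∀ h, h ≠ 0 → 0 ≤ k h
  radial : ∀ h h', h ≠ 0 → ‖h‖ = ‖h'‖ → k h = k h'

/-- Families `(α_ε)` of radial functions and `(μ_ε(h) dh)` of measures with radial densities,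
`ε ∈ (0,1)`, that satisfy the normalization (L1) and the concentration property (L2).
For `d ≥ 1`, (L1) includes that the integral converges, since its value is not zero. -/
structure IsRadialLevyFamily {d : ℕ} (α μ : ℝ → EuclideanSpace ℝ (Fin d) → ℝ) : Prop where
  kernel_left : ∀ ε ∈ Ioo (0 : ℝ) 1, IsRadialKernel (α ε)
  kernel_right : ∀ ε ∈ Ioo (0 : ℝ) 1, IsRadialKernel (μ ε)
  normalized : ∀ ε ∈ Ioo (0 : ℝ) 1, ∫ h, min 1 (‖h‖ ^ 2) * (α ε h * μ ε h) = d
  concentrates : ∀ δ : ℝ, 0 < δ →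
    Tendsto (fun ε => ∫ h in {h | δ < ‖h‖}, α ε h * μ ε h) (𝓝[>] 0) (𝓝 0)

/-- The nonlocal vector field generated by `F : ℝᵈ → ℝᵈ` with respect to `α`:
`f_α(x, y) = α(x - y) ∫₀¹ F(x + t (y - x)) · (y - x) dt`. In particular `f_α(x, x) = 0`. -/
noncomputable def nonlocalField {d : ℕ} (α : EuclideanSpace ℝ (Fin d) → ℝ)
    (F : EuclideanSpace ℝ (Fin d) → EuclideanSpace ℝ (Fin d))
    (x y : EuclideanSpace ℝ (Fin d)) : ℝ :=
  α (x - y) * ∫ t in (0 : ℝ)..1, inner ℝ (F (x + t • (y - x))) (y - x)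

/-- The nonlocal normal operator `N_μ f(x) = -2 ∫_Ω f(x, y) μ(y - x) dy`, for `x ∈ Ωᶜ`. -/
noncomputable def nonlocalNormal {d : ℕ} (μ : EuclideanSpace ℝ (Fin d) → ℝ)
    (Ω : Set (EuclideanSpace ℝ (Fin d)))
    (f : EuclideanSpace ℝ (Fin d) → EuclideanSpace ℝ (Fin d) → ℝ)
    (x : EuclideanSpace ℝ (Fin d)) : ℝ :=
  -2 * ∫ y in Ω, f x y * μ (y - x)

/-! ### Area formula for the Hausdorff measure. -/

section AreaFormula

open scoped NNReal ENNReal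

/-! Put k = αμ and let L(w, h) be the line integral of G along the segment from w to w + h. In the
variables x = w + h, y = w the integral of the nonlocal normal operator over Ωᶜ becomes 2 ∫ k(h)
E(h) dh, where E(h) (`exitFlux`) integrates L(w, h) over those w in Ω with w + h outside Ω. As k is
even, this equals ∫ k(h) (E(h) + E(-h)) dh (`integral_nonlocalNormal`).

The symmetrised flux is a bulk quantity. Reversing a segment changes the sign of L, so segments with
both ends in Ω contribute nothing, and E(h) + E(-h) = ∫_Ω (L(w, h) + L(w, -h)) dw
(`exitFlux_add_exitFlux_neg`). The terms linear in h cancel here, and the integrand is ⟨DG(w) h, h⟩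
+ o(|h|²) uniformly in w. Hence E(h) + E(-h) has a quadratic expansion at 0 with matrix ∫_Ω ∂ᵢGⱼ
(`exitFlux_expansion`). By symmetry and (L1) the truncated second moments of k form the identity
matrix, and by (L2) only the expansion at 0 matters in the limit, which is therefore the trace ∫_Ω
div G (`tendsto_integral_kernel_mul`).

Absolute convergence rests on |E(h)| ≤ C min(1, |h|²): the set of exiting points has volume O(|h|)
(`IsBoundedC1Domain.exists_volume_le`), and L is O(min(1, |h|)) because G has compact support.

It remains to prove the divergence theorem on Ω (`IsBoundedC1Domain.sum_setIntegral_fderiv`). A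
partition of unity reduces it to the region below a graph. Flattening the graph preserves volume,
Fubini yields the boundary term, and the area formula, obtained by differentiating Hausdorff measure
with respect to Lebesgue measure, rewrites that term as a surface integral. -/

lemma hausdorffMeasure_image_le_of_edist_le {T X Y : Type*} [EMetricSpace X] [EMetricSpace Y]
    [MeasurableSpace X] [BorelSpace X] [MeasurableSpace Y] [BorelSpace Y] {f : T → X} {g : T → Y}
    {s : Set T} {K : ℝ≥0} (h : ∀ x ∈ s, ∀ y ∈ s, edist (f x) (f y) ≤ K * edist (g x) (g y))
    {d : ℝ} (hd : 0 ≤ d) :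
    Measure.hausdorffMeasure d (f '' s) ≤ (K : ℝ≥0∞) ^ d * Measure.hausdorffMeasure d (g '' s) := by
  classical
  rcases s.eq_empty_or_nonempty with rfl | ⟨x₀, hx₀⟩
  · simp
  have : Nonempty T := ⟨x₀⟩
  -- `g` need not be injective, but the estimate makes `f` constant on the fibres of `g` in `s`.
  -- Hence `f` factors through `g` by the Lipschitz map `f ∘ k`, for any choice of section `k`.
  set k : Y → T := Function.invFunOn g s with hk
  have hk1 : ∀ x ∈ s, k (g x) ∈ s := fun x hx => Function.invFunOn_mem ⟨x, hx, rfl⟩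
  have hk2 : ∀ x ∈ s, g (k (g x)) = g x := fun x hx => Function.invFunOn_eq ⟨x, hx, rfl⟩
  have hfk : ∀ x ∈ s, f (k (g x)) = f x := by
    intro x hx
    have := h _ (hk1 x hx) x hx
    rw [hk2 x hx, edist_self, mul_zero] at this
    exact edist_le_zero.1 this
  have himg : f '' s = (f ∘ k) '' (g '' s) := by
    rw [image_image]
    exact image_congr fun x hx => (hfk x hx).symm
  have hl : LipschitzOnWith K (f ∘ k) (g '' s) := by
    rintro _ ⟨x, hx, rfl⟩ _ ⟨y, hy, rfl⟩
    simp only [Function.comp_apply, hfk x hx, hfk y hy]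
    exact h x hx y hy
  rw [himg]
  exact hl.hausdorffMeasure_image_le hd

lemma euclideanHausdorffMeasure_image_le_of_edist_le {T X Y : Type*} [EMetricSpace X]
    [EMetricSpace Y] [MeasurableSpace X] [BorelSpace X] [MeasurableSpace Y] [BorelSpace Y]
    {f : T → X} {g : T → Y} {s : Set T} {K : ℝ≥0}
    (h : ∀ x ∈ s, ∀ y ∈ s, edist (f x) (f y) ≤ K * edist (g x) (g y)) (d : ℕ) :
    Measure.euclideanHausdorffMeasure d (f '' s) ≤
      (K : ℝ≥0∞) ^ d * Measure.euclideanHausdorffMeasure d (g '' s) := by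
  have := hausdorffMeasure_image_le_of_edist_le h (d := d) (Nat.cast_nonneg d)
  simp only [Measure.euclideanHausdorffMeasure_def, Measure.smul_apply, ENNReal.smul_def,
    smul_eq_mul]
  rw [ENNReal.rpow_natCast] at this
  calc _ ≤ _ := mul_le_mul_right this _
    _ = _ := by ring

lemma LinearMap.euclideanHausdorffMeasure_image_fin {n : ℕ} {V : Type*} [NormedAddCommGroup V]
    [InnerProductSpace ℝ V] [MeasurableSpace V] [BorelSpace V]
    (A : EuclideanSpace ℝ (Fin n) →ₗ[ℝ] V) (s : Set (EuclideanSpace ℝ (Fin n))) :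
    Measure.euclideanHausdorffMeasure n (A '' s) = ENNReal.ofReal A.normDet * volume s := by
  have := A.hausdorffMeasure_image s
  rw [finrank_euclideanSpace_fin] at this
  rw [← EuclideanSpace.euclideanHausdorffMeasure_eq_volume]
  simp only [Measure.euclideanHausdorffMeasure_def, Measure.smul_apply, ENNReal.smul_def,
    smul_eq_mul, this]
  ring

variable {n : ℕ} {V : Type*} [NormedAddCommGroup V] [InnerProductSpace ℝ V] [MeasurableSpace V]
  [BorelSpace V] {Φ : EuclideanSpace ℝ (Fin n) → V}

omit [MeasurableSpace V] [BorelSpace V] in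
/-- On small sets, a `C¹` immersion that does not contract to first order distorts the image of its
differential by a factor close to `1`. -/
lemma exists_nhds_norm_sub_le (hΦ : ContDiff ℝ 1 Φ) (hexp : ∀ x v, ‖v‖ ≤ ‖fderiv ℝ Φ x v‖)
    (p : EuclideanSpace ℝ (Fin n)) {ε : ℝ} (hε : 0 < ε) :
    ∃ s ∈ 𝓝 p, ∀ x ∈ s, ∀ y ∈ s,
      ‖Φ x - Φ y‖ ≤ (1 + ε) * ‖fderiv ℝ Φ p (x - y)‖ ∧
      (1 - ε) * ‖fderiv ℝ Φ p (x - y)‖ ≤ ‖Φ x - Φ y‖ := by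
  have hs : HasStrictFDerivAt Φ (fderiv ℝ Φ p) p :=
    hΦ.contDiffAt.hasStrictFDerivAt one_ne_zero
  obtain ⟨s, hs, happ⟩ := hs.approximates_deriv_on_nhds (c := ε.toNNReal)
    (Or.inr (Real.toNNReal_pos.2 hε))
  refine ⟨s, hs, fun x hx y hy => ?_⟩
  have h1 := happ x hx y hy
  rw [Real.coe_toNNReal _ hε.le] at h1
  -- Non-contraction turns the error ε‖x - y‖ of strict differentiability into an error relative to
  -- ‖DΦ(p)(x - y)‖.
  have h2 := mul_le_mul_of_nonneg_left (hexp p (x - y)) hε.le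
  have h3 := norm_sub_norm_le (Φ x - Φ y) (fderiv ℝ Φ p (x - y))
  have h4 := norm_sub_norm_le (fderiv ℝ Φ p (x - y)) (Φ x - Φ y)
  rw [norm_sub_rev (fderiv ℝ Φ p (x - y)) (Φ x - Φ y)] at h4
  constructor <;> linarith

/-- On small balls Φ and its differential at p distort distances alike up to factors 1 ± ε, so the
measures of the two images agree up to n-th powers of these factors. The linear image has measure
`normDet` times the volume of the ball; let the radius and then ε tend to 0. -/
lemma eq_normDet_of_tendsto (hΦ : ContDiff ℝ 1 Φ) (hexp : ∀ x v, ‖v‖ ≤ ‖fderiv ℝ Φ x v‖)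
    (p : EuclideanSpace ℝ (Fin n)) {L : ℝ≥0∞}
    (hL : Tendsto (fun r => Measure.euclideanHausdorffMeasure n (Φ '' Metric.closedBall p r) /
      volume (Metric.closedBall p r)) (𝓝[>] 0) (𝓝 L)) :
    L = ENNReal.ofReal (fderiv ℝ Φ p).toLinearMap.normDet := by
  set J := ENNReal.ofReal (fderiv ℝ Φ p).toLinearMap.normDet with hJ
  have hev : ∀ s ∈ 𝓝 p, ∀ᶠ r in 𝓝[>] (0 : ℝ), 0 < r ∧ Metric.closedBall p r ⊆ s := by
    intro s hs
    obtain ⟨δ, hδ, hsub⟩ := Metric.nhds_basis_closedBall.mem_iff.1 hs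
    filter_upwards [Ioc_mem_nhdsGT hδ] with r hr
    exact ⟨hr.1, (Metric.closedBall_subset_closedBall hr.2).trans hsub⟩
  have hvol : ∀ r : ℝ, 0 < r → volume (Metric.closedBall p r) ≠ 0 :=
    fun r hr => (Metric.measure_closedBall_pos _ _ hr).ne'
  have hvol' : ∀ r : ℝ, volume (Metric.closedBall p r) ≠ ⊤ :=
    fun r => measure_closedBall_lt_top.ne
  have hup : ∀ ε : ℝ, 0 < ε → L ≤ ENNReal.ofReal (1 + ε) ^ n * J := by
    intro ε hε
    obtain ⟨s, hs, hb⟩ := exists_nhds_norm_sub_le hΦ hexp p hε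
    refine le_of_tendsto hL ?_
    filter_upwards [hev s hs] with r hr
    rw [ENNReal.div_le_iff (hvol r hr.1) (hvol' r), mul_assoc, hJ,
      ← LinearMap.euclideanHausdorffMeasure_image_fin]
    refine euclideanHausdorffMeasure_image_le_of_edist_le (K := (1 + ε).toNNReal) ?_ n
    intro x hx y hy
    have := (hb x (hr.2 hx) y (hr.2 hy)).1
    rw [edist_dist, edist_dist, dist_eq_norm, dist_eq_norm, ← map_sub]
    change _ ≤ ENNReal.ofReal _ * _
    rw [← ENNReal.ofReal_mul (by linarith)]
    exact ENNReal.ofReal_le_ofReal this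
  have hlo : ∀ ε : ℝ, 0 < ε → ε < 1 → J ≤ ENNReal.ofReal (1 - ε)⁻¹ ^ n * L := by
    intro ε hε hε1
    obtain ⟨s, hs, hb⟩ := exists_nhds_norm_sub_le hΦ hexp p hε
    refine ge_of_tendsto (ENNReal.Tendsto.const_mul hL (Or.inr (by simp))) ?_
    filter_upwards [hev s hs] with r hr
    rw [← mul_div_assoc, ENNReal.le_div_iff_mul_le (Or.inl (hvol r hr.1)) (Or.inl (hvol' r)), hJ,
      ← LinearMap.euclideanHausdorffMeasure_image_fin]
    refine euclideanHausdorffMeasure_image_le_of_edist_le (K := ((1 - ε)⁻¹).toNNReal) ?_ n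
    intro x hx y hy
    have := (hb x (hr.2 hx) y (hr.2 hy)).2
    have h1 : 0 < 1 - ε := by linarith
    rw [edist_dist, edist_dist, dist_eq_norm, dist_eq_norm, ← map_sub]
    change _ ≤ ENNReal.ofReal _ * _
    rw [← ENNReal.ofReal_mul (by positivity)]
    refine ENNReal.ofReal_le_ofReal ?_
    rw [inv_mul_eq_div, le_div_iff₀' h1]
    exact this
  refine le_antisymm ?_ ?_
  · have ht : Tendsto (fun ε : ℝ => ENNReal.ofReal (1 + ε) ^ n * J) (𝓝[>] 0)
        (𝓝 (ENNReal.ofReal (1 + 0) ^ n * J)) := by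
      refine ENNReal.Tendsto.mul_const (ENNReal.Tendsto.pow (ENNReal.tendsto_ofReal ?_))
        (Or.inr ENNReal.ofReal_ne_top)
      exact ((continuous_const.add continuous_id).tendsto (0 : ℝ)).mono_left nhdsWithin_le_nhds
    simp only [add_zero, ENNReal.ofReal_one, one_pow, one_mul] at ht
    refine ge_of_tendsto ht ?_
    filter_upwards [self_mem_nhdsWithin] with ε hε using hup ε hε
  · have ht : Tendsto (fun ε : ℝ => ENNReal.ofReal (1 - ε)⁻¹ ^ n * L) (𝓝[>] 0)
        (𝓝 (ENNReal.ofReal (1 - 0)⁻¹ ^ n * L)) := by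
      have hc : ContinuousAt (fun ε : ℝ => (1 - ε)⁻¹) 0 := by
        refine ContinuousAt.inv₀ (by fun_prop) (by norm_num)
      refine ENNReal.Tendsto.mul_const (ENNReal.Tendsto.pow (ENNReal.tendsto_ofReal
        (hc.tendsto.mono_left nhdsWithin_le_nhds))) (Or.inl ?_)
      simp
    simp only [sub_zero, inv_one, ENNReal.ofReal_one, one_pow, one_mul] at ht
    refine ge_of_tendsto ht ?_
    filter_upwards [Ioo_mem_nhdsGT (zero_lt_one' ℝ)] with ε hε using hlo ε hε.1 hε.2

/-- **Area formula** for a `C¹` embedding that does not contract to first order. -/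
theorem comap_euclideanHausdorffMeasure (hΦ : ContDiff ℝ 1 Φ) (hemb : MeasurableEmbedding Φ)
    (hexp : ∀ x v, ‖v‖ ≤ ‖fderiv ℝ Φ x v‖) :
    (Measure.euclideanHausdorffMeasure n).comap Φ =
      volume.withDensity fun x => ENNReal.ofReal (fderiv ℝ Φ x).toLinearMap.normDet := by
  set ν := (Measure.euclideanHausdorffMeasure n : Measure V).comap Φ with hν
  have hνa : ∀ s, ν s = Measure.euclideanHausdorffMeasure n (Φ '' s) :=
    fun s => hemb.comap_apply _ s
  have hle : ∀ (K : ℝ≥0) (s : Set (EuclideanSpace ℝ (Fin n))), LipschitzOnWith K Φ s →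
      ν s ≤ (K : ℝ≥0∞) ^ n * volume s := by
    intro K s hs
    rw [hνa, ← EuclideanSpace.euclideanHausdorffMeasure_eq_volume]
    have := euclideanHausdorffMeasure_image_le_of_edist_le (f := Φ) (g := id) (s := s) (K := K)
      (fun x hx y hy => hs hx hy) n
    simpa using this
  have : IsLocallyFiniteMeasure ν := by
    refine ⟨fun x => ?_⟩
    obtain ⟨K, t, ht, hK⟩ := hΦ.locallyLipschitz x
    obtain ⟨δ, hδ, hsub⟩ := Metric.nhds_basis_closedBall.mem_iff.1 ht
    refine ⟨_, Metric.closedBall_mem_nhds x hδ, (hle K _ (hK.mono hsub)).trans_lt ?_⟩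
    exact ENNReal.mul_lt_top (by simp) measure_closedBall_lt_top
  have hac : ν ≪ volume := by
    intro s hs
    have : s ⊆ ⋃ k : ℕ, s ∩ Metric.closedBall 0 (k : ℝ) := by
      rw [← inter_iUnion, Metric.iUnion_closedBall_nat, inter_univ]
    refine measure_mono_null this (measure_iUnion_null fun k => ?_)
    obtain ⟨K, hK⟩ := (hΦ.locallyLipschitz.locallyLipschitzOn
      (s := Metric.closedBall 0 (k : ℝ))).exists_lipschitzOnWith_of_compact
        (isCompact_closedBall _ _)
    have := hle K _ (hK.mono (inter_subset_right (s := s)))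
    rw [measure_mono_null inter_subset_left hs, mul_zero] at this
    exact le_antisymm this bot_le
  rw [← Measure.withDensity_rnDeriv_eq ν volume hac]
  refine withDensity_congr_ae ?_
  -- Besicovitch differentiation: almost everywhere the density of ν is the limit of the ratios
  -- ν(B)/vol(B) over shrinking closed balls.
  filter_upwards [Besicovitch.ae_tendsto_rnDeriv ν volume] with x hx
  simp only [hνa] at hx
  exact eq_normDet_of_tendsto hΦ hexp x hx

end AreaFormula

/-! ### Splitting off the last coordinate. -/

section GraphCoordinates

/-- The linear coordinates `(x', s) ↦ (x', s)` from `ℝⁿ × ℝ` onto `ℝⁿ⁺¹`. -/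
noncomputable def snocEquiv (n : ℕ) :
    (EuclideanSpace ℝ (Fin n) × ℝ) ≃L[ℝ] EuclideanSpace ℝ (Fin (n + 1)) :=
  LinearEquiv.toContinuousLinearEquiv
    { toFun := fun p => WithLp.toLp 2 (Fin.snoc (α := fun _ => ℝ) p.1 p.2)
      map_add' := fun p q => by
        ext i
        refine Fin.lastCases ?_ (fun i => ?_) i <;> simp
      map_smul' := fun c p => by
        ext i
        refine Fin.lastCases ?_ (fun i => ?_) i <;> simp
      invFun := fun y => (WithLp.toLp 2 fun i : Fin n => y i.castSucc, y (Fin.last n))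
      left_inv := fun p => by
        ext i <;> simp
      right_inv := fun y => by
        ext i
        refine Fin.lastCases ?_ (fun i => ?_) i <;> simp }

variable {n : ℕ}

@[simp]
lemma snocEquiv_apply_last (p : EuclideanSpace ℝ (Fin n) × ℝ) :
    snocEquiv n p (Fin.last n) = p.2 :=
  Fin.snoc_last (α := fun _ => ℝ) p.2 p.1.ofLp

@[simp]
lemma snocEquiv_apply_castSucc (p : EuclideanSpace ℝ (Fin n) × ℝ) (i : Fin n) :
    snocEquiv n p i.castSucc = p.1 i :=
  Fin.snoc_castSucc (α := fun _ => ℝ) p.2 p.1.ofLp i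

lemma inner_snocEquiv (p q : EuclideanSpace ℝ (Fin n) × ℝ) :
    inner ℝ (snocEquiv n p) (snocEquiv n q) = inner ℝ p.1 q.1 + p.2 * q.2 := by
  simp only [PiLp.inner_apply, Fin.sum_univ_castSucc, snocEquiv_apply_last,
    snocEquiv_apply_castSucc]
  simp [mul_comm]

lemma norm_sq_snocEquiv (p : EuclideanSpace ℝ (Fin n) × ℝ) :
    ‖snocEquiv n p‖ ^ 2 = ‖p.1‖ ^ 2 + p.2 ^ 2 := by
  rw [← real_inner_self_eq_norm_sq, inner_snocEquiv, real_inner_self_eq_norm_sq]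
  ring

lemma measurePreserving_snocEquiv : MeasurePreserving (snocEquiv n) volume volume := by
  have h1 := (volume_preserving_piFinSuccAbove (fun _ : Fin (n + 1) => ℝ) (Fin.last n)).symm
  have h2 : MeasurePreserving (Prod.swap : (Fin n → ℝ) × ℝ → ℝ × (Fin n → ℝ)) volume volume :=
    Measure.measurePreserving_swap
  have h3 : MeasurePreserving (Prod.map (WithLp.ofLp : EuclideanSpace ℝ (Fin n) → Fin n → ℝ)
      (id : ℝ → ℝ))
      volume volume :=
    (PiLp.volume_preserving_ofLp (Fin n)).prod (MeasurePreserving.id volume)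
  have h4 := (PiLp.volume_preserving_toLp (Fin (n + 1))).comp (h1.comp (h2.comp h3))
  have h5 : ⇑(snocEquiv n) = WithLp.toLp 2 ∘
      (MeasurableEquiv.piFinSuccAbove (fun _ : Fin (n + 1) => ℝ) (Fin.last n)).symm ∘
        Prod.swap ∘ Prod.map WithLp.ofLp id := by
    funext p
    ext i
    refine Fin.lastCases ?_ (fun i => ?_) i <;>
      simp [MeasurableEquiv.piFinSuccAbove, Fin.insertNthEquiv, -Fin.insertNth_last']
    rw [← Fin.succAbove_last_apply, Fin.insertNth_apply_succAbove]
  rw [h5]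
  exact h4

end GraphCoordinates

/-! ### Flattening a graph. -/

section GraphChart

variable {n : ℕ}
  (φ : EuclideanSpace ℝ (Fin (n + 1)) ≃ᵃⁱ[ℝ] EuclideanSpace ℝ (Fin (n + 1)))
  (γ : EuclideanSpace ℝ (Fin n) → ℝ)

/-- Graph coordinates: `(x', u)` is sent to the point at (signed) height `u` over the graph of `γ`,
up to the rigid motion `φ`. -/
noncomputable def graphParam (p : EuclideanSpace ℝ (Fin n) × ℝ) : EuclideanSpace ℝ (Fin (n + 1)) :=
  φ.symm (snocEquiv n (p.1, γ p.1 + p.2))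

/-- The inverse of `graphParam`. -/
noncomputable def graphCoord (y : EuclideanSpace ℝ (Fin (n + 1))) : EuclideanSpace ℝ (Fin n) × ℝ :=
  (((snocEquiv n).symm (φ y)).1, ((snocEquiv n).symm (φ y)).2 - γ ((snocEquiv n).symm (φ y)).1)

@[simp]
lemma graphCoord_graphParam (p : EuclideanSpace ℝ (Fin n) × ℝ) :
    graphCoord φ γ (graphParam φ γ p) = p := by
  simp [graphCoord, graphParam]

@[simp]
lemma graphParam_graphCoord (y : EuclideanSpace ℝ (Fin (n + 1))) :
    graphParam φ γ (graphCoord φ γ y) = y := by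
  simp [graphCoord, graphParam]

lemma contDiff_affineIsometryEquiv (χ : EuclideanSpace ℝ (Fin (n + 1)) ≃ᵃⁱ[ℝ]
    EuclideanSpace ℝ (Fin (n + 1))) : ContDiff ℝ 1 χ :=
  χ.toContinuousAffineEquiv.toContinuousAffineMap.contDiff

lemma hasFDerivAt_affineIsometryEquiv (χ : EuclideanSpace ℝ (Fin (n + 1)) ≃ᵃⁱ[ℝ]
    EuclideanSpace ℝ (Fin (n + 1))) (y : EuclideanSpace ℝ (Fin (n + 1))) :
    HasFDerivAt χ (χ.linearIsometryEquiv.toContinuousLinearEquiv :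
      EuclideanSpace ℝ (Fin (n + 1)) →L[ℝ] EuclideanSpace ℝ (Fin (n + 1))) y := by
  have h : ⇑χ = fun x => χ.linearIsometryEquiv x + χ 0 := by
    funext x
    have := χ.map_vadd 0 x
    simpa using this
  rw [h]
  exact χ.linearIsometryEquiv.toContinuousLinearEquiv.hasFDerivAt.add_const _

variable {γ}

lemma contDiff_graphParam (hγ : ContDiff ℝ 1 γ) : ContDiff ℝ 1 (graphParam φ γ) := by
  refine (contDiff_affineIsometryEquiv φ.symm).comp ((snocEquiv n).contDiff.comp ?_)
  exact contDiff_fst.prodMk ((hγ.comp contDiff_fst).add contDiff_snd)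

lemma contDiff_graphCoord (hγ : ContDiff ℝ 1 γ) : ContDiff ℝ 1 (graphCoord φ γ) := by
  have h : ContDiff ℝ 1 fun y => (snocEquiv n).symm (φ y) :=
    (snocEquiv n).symm.contDiff.comp (contDiff_affineIsometryEquiv φ)
  exact h.fst.prodMk (h.snd.sub (hγ.comp h.fst))

/-- Graph coordinates as a homeomorphism. -/
noncomputable def graphHomeomorph (hγ : ContDiff ℝ 1 γ) :
    EuclideanSpace ℝ (Fin n) × ℝ ≃ₜ EuclideanSpace ℝ (Fin (n + 1)) where
  toFun := graphParam φ γ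
  invFun := graphCoord φ γ
  left_inv := graphCoord_graphParam φ γ
  right_inv := graphParam_graphCoord φ γ
  continuous_toFun := (contDiff_graphParam φ hγ).continuous
  continuous_invFun := (contDiff_graphCoord φ hγ).continuous

lemma measurePreserving_affineIsometryEquiv (χ : EuclideanSpace ℝ (Fin (n + 1)) ≃ᵃⁱ[ℝ]
    EuclideanSpace ℝ (Fin (n + 1))) : MeasurePreserving χ volume volume := by
  have := χ.toIsometryEquiv.measurePreserving_euclideanHausdorffMeasure (n + 1)
  rwa [EuclideanSpace.euclideanHausdorffMeasure_eq_volume] at this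

/-- The shear (x', u) ↦ (x', γ(x') + u) translates each vertical line, so it preserves volume by
Fubini; the other factors are isometries. -/
lemma measurePreserving_graphParam (hγ : ContDiff ℝ 1 γ) :
    MeasurePreserving (graphParam φ γ) volume volume := by
  have h : MeasurePreserving (fun p : EuclideanSpace ℝ (Fin n) × ℝ => (p.1, γ p.1 + p.2))
      volume volume := by
    refine MeasurePreserving.skew_product (f := id) (g := fun x s => γ x + s)
      (MeasurePreserving.id volume) ?_ ?_
    · exact ((hγ.continuous.comp continuous_fst).add continuous_snd).measurable
    · exact Eventually.of_forall fun x => (measurePreserving_add_left volume (γ x)).map_eq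
  exact (measurePreserving_affineIsometryEquiv φ.symm).comp (measurePreserving_snocEquiv.comp h)

lemma measurableEmbedding_graphParam (hγ : ContDiff ℝ 1 γ) :
    MeasurableEmbedding (graphParam φ γ) :=
  (graphHomeomorph φ hγ).measurableEmbedding

lemma hasFDerivAt_graphParam (hγ : ContDiff ℝ 1 γ) (p : EuclideanSpace ℝ (Fin n) × ℝ) :
    HasFDerivAt (graphParam φ γ)
      ((φ.symm.linearIsometryEquiv.toContinuousLinearEquiv :
          EuclideanSpace ℝ (Fin (n + 1)) →L[ℝ] EuclideanSpace ℝ (Fin (n + 1))) ∘L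
        (snocEquiv n : EuclideanSpace ℝ (Fin n) × ℝ →L[ℝ] EuclideanSpace ℝ (Fin (n + 1))) ∘L
        (ContinuousLinearMap.fst ℝ _ ℝ).prod
          (fderiv ℝ γ p.1 ∘L ContinuousLinearMap.fst ℝ _ ℝ + ContinuousLinearMap.snd ℝ _ ℝ)) p := by
  refine (hasFDerivAt_affineIsometryEquiv φ.symm _).comp p ((snocEquiv n).hasFDerivAt.comp p ?_)
  refine hasFDerivAt_fst.prodMk (HasFDerivAt.add ?_ hasFDerivAt_snd)
  exact ((hγ.differentiable one_ne_zero) p.1).hasFDerivAt.comp p hasFDerivAt_fst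

/-- The vector `L v` in graph coordinates, `L` the linear part of `φ`. -/
noncomputable def graphVec (v : EuclideanSpace ℝ (Fin (n + 1))) : EuclideanSpace ℝ (Fin n) × ℝ :=
  (snocEquiv n).symm (φ.linearIsometryEquiv v)

lemma linearIsometryEquiv_symm_apply_apply (v : EuclideanSpace ℝ (Fin (n + 1))) :
    φ.symm.linearIsometryEquiv (φ.linearIsometryEquiv v) = v :=
  φ.linearIsometryEquiv.symm_apply_apply v

/-- The constant direction v reads (v', v_d - Dγ(x')v') in graph coordinates. The coefficient of the
vertical derivative depends on x' alone, so it can be pulled out of integrals over vertical lines.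
-/
lemma fderiv_comp_graphParam (hγ : ContDiff ℝ 1 γ) {g : EuclideanSpace ℝ (Fin (n + 1)) → ℝ}
    (hg : ContDiff ℝ 1 g) (p : EuclideanSpace ℝ (Fin n) × ℝ)
    (v : EuclideanSpace ℝ (Fin (n + 1))) :
    fderiv ℝ g (graphParam φ γ p) v =
      fderiv ℝ (g ∘ graphParam φ γ) p ((graphVec φ v).1, 0) +
      ((graphVec φ v).2 - fderiv ℝ γ p.1 (graphVec φ v).1) *
        fderiv ℝ (g ∘ graphParam φ γ) p (0, 1) := by
  have h := ((hg.differentiable one_ne_zero) (graphParam φ γ p)).hasFDerivAt.comp p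
    (hasFDerivAt_graphParam φ hγ p)
  rw [← smul_eq_mul, ← map_smul, ← map_add, h.fderiv]
  simp only [ContinuousLinearMap.comp_apply, ContinuousLinearMap.prod_apply]
  congr 1
  symm
  simp [graphVec, linearIsometryEquiv_symm_apply_apply]

end GraphChart

/-! ### Divergence theorem below a graph, in coordinates. -/

section Divergence

/-- Integration by parts against the constant function 1. -/
lemma HasCompactSupport.integral_fderiv_apply_eq_zero {E : Type*} [NormedAddCommGroup E]
    [NormedSpace ℝ E] [FiniteDimensional ℝ E] [MeasurableSpace E] [BorelSpace E]
    (μ : Measure E) [μ.IsAddHaarMeasure] {g : E → ℝ} (hg : ContDiff ℝ 1 g)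
    (hc : HasCompactSupport g) (v : E) :
    ∫ x, fderiv ℝ g x v ∂μ = 0 := by
  have h1 : Integrable (fun x => fderiv ℝ g x v) μ := by
    refine Continuous.integrable_of_hasCompactSupport
      ((hg.continuous_fderiv one_ne_zero).clm_apply continuous_const) ?_
    exact (hc.fderiv (𝕜 := ℝ)).comp_left (g := fun A : E →L[ℝ] ℝ => A v) (by simp)
  have := integral_mul_fderiv_eq_neg_fderiv_mul_of_integrable (f := fun _ : E => (1 : ℝ)) (g := g)
    (v := v) (μ := μ) (by simp) (by simpa using h1)
    (by simpa using hg.continuous.integrable_of_hasCompactSupport hc) (by simp)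
    (fun x _ => (hg.differentiable one_ne_zero) x)
  simpa using this

variable {n : ℕ}
  (φ : EuclideanSpace ℝ (Fin (n + 1)) ≃ᵃⁱ[ℝ] EuclideanSpace ℝ (Fin (n + 1)))
  {γ : EuclideanSpace ℝ (Fin n) → ℝ}

/-- The divergence theorem below a graph, in graph coordinates. -/
lemma setIntegral_fderiv_graphParam (hγ : ContDiff ℝ 1 γ)
    {g : EuclideanSpace ℝ (Fin (n + 1)) → ℝ} (hg : ContDiff ℝ 1 g) (hc : HasCompactSupport g)
    (v : EuclideanSpace ℝ (Fin (n + 1))) :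
    ∫ p in {p : EuclideanSpace ℝ (Fin n) × ℝ | p.2 < 0}, fderiv ℝ g (graphParam φ γ p) v =
      ∫ x, ((graphVec φ v).2 - fderiv ℝ γ x (graphVec φ v).1) * g (graphParam φ γ (x, 0)) := by
  set K := g ∘ graphParam φ γ with hK
  have hK1 : ContDiff ℝ 1 K := hg.comp (contDiff_graphParam φ hγ)
  have hKc : HasCompactSupport K := hc.comp_homeomorph (graphHomeomorph φ hγ)
  have hint : ∀ w : EuclideanSpace ℝ (Fin n) × ℝ, Continuous fun p => fderiv ℝ K p w := fun w =>
    (hK1.continuous_fderiv one_ne_zero).clm_apply continuous_const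
  have hcs : ∀ w : EuclideanSpace ℝ (Fin n) × ℝ, HasCompactSupport fun p => fderiv ℝ K p w :=
    fun w => (hKc.fderiv (𝕜 := ℝ)).comp_left
      (g := fun A : (EuclideanSpace ℝ (Fin n) × ℝ) →L[ℝ] ℝ => A w) (by simp)
  set a : EuclideanSpace ℝ (Fin n) → ℝ :=
    fun x => (graphVec φ v).2 - fderiv ℝ γ x (graphVec φ v).1 with ha
  have hac : Continuous a :=
    continuous_const.sub ((hγ.continuous_fderiv one_ne_zero).clm_apply continuous_const)
  have hset : {p : EuclideanSpace ℝ (Fin n) × ℝ | p.2 < 0} = univ ×ˢ Iio 0 := by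
    ext p; simp
  have hrestr : (volume : Measure (EuclideanSpace ℝ (Fin n) × ℝ)).restrict (univ ×ˢ Iio 0) =
      (volume : Measure (EuclideanSpace ℝ (Fin n))).prod (volume.restrict (Iio (0 : ℝ))) := by
    rw [Measure.volume_eq_prod, ← Measure.prod_restrict, Measure.restrict_univ]
  have i1 : Integrable (fun p => fderiv ℝ K p ((graphVec φ v).1, 0))
      ((volume : Measure (EuclideanSpace ℝ (Fin n))).prod (volume.restrict (Iio (0 : ℝ)))) := by
    rw [← hrestr]
    exact ((hint _).integrable_of_hasCompactSupport (hcs _)).integrableOn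
  have i2 : Integrable (fun p => a p.1 * fderiv ℝ K p (0, 1))
      ((volume : Measure (EuclideanSpace ℝ (Fin n))).prod (volume.restrict (Iio (0 : ℝ)))) := by
    rw [← hrestr]
    exact (((hac.comp continuous_fst).mul (hint _)).integrable_of_hasCompactSupport
      ((hcs _).mul_left)).integrableOn
  rw [hset, hrestr]
  simp only [fderiv_comp_graphParam φ hγ hg]
  -- Opposite orders of integration: the horizontal derivative integrates to zero on each horizontal
  -- slice, the vertical one to the boundary value K(x, 0) on each vertical half-line. No derivative
  -- falls on Dγ, so γ of class C¹ suffices.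
  rw [integral_add i1 i2, integral_prod_symm _ i1, integral_prod _ i2]
  have z1 : ∀ s : ℝ, ∫ x, fderiv ℝ K (x, s) ((graphVec φ v).1, 0) = 0 := by
    intro s
    have hs : IsClosedEmbedding fun x : EuclideanSpace ℝ (Fin n) => (x, s) :=
      ⟨isEmbedding_prodMkLeft s, by
        have : range (fun x : EuclideanSpace ℝ (Fin n) => (x, s)) = univ ×ˢ {s} := by
          ext p; simp [Prod.ext_iff, eq_comm]
        rw [this]
        exact isClosed_univ.prod isClosed_singleton⟩
    have := HasCompactSupport.integral_fderiv_apply_eq_zero (g := fun x => K (x, s)) volume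
      (hK1.comp (contDiff_id.prodMk contDiff_const)) (hKc.comp_isClosedEmbedding hs)
      (graphVec φ v).1
    refine Eq.trans ?_ this
    refine integral_congr_ae (Eventually.of_forall fun x => ?_)
    have h1 : HasFDerivAt (fun x : EuclideanSpace ℝ (Fin n) => (x, s))
        (ContinuousLinearMap.inl ℝ _ ℝ) x := hasFDerivAt_prodMk_left x s
    have h2 := ((hK1.differentiable one_ne_zero) (x, s)).hasFDerivAt.comp x h1
    have h3 := h2.fderiv
    simp only [Function.comp_def] at h3
    simp [h3]
  have z2 : ∀ x, ∫ s in Iio (0 : ℝ), fderiv ℝ K (x, s) (0, 1) = K (x, 0) := by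
    intro x
    have hs : IsClosedEmbedding fun s : ℝ => (x, s) := 
      ⟨isEmbedding_prodMkRight x, by
        have : range (fun s : ℝ => (x, s)) = {x} ×ˢ univ := by
          ext p; simp [Prod.ext_iff, eq_comm]
        rw [this]
        exact isClosed_singleton.prod isClosed_univ⟩
    have hd : ∀ s, HasDerivAt (fun s => K (x, s)) (fderiv ℝ K (x, s) (0, 1)) s := by
      intro s
      have h1 : HasDerivAt (fun s : ℝ => (x, s)) ((0 : EuclideanSpace ℝ (Fin n)), (1 : ℝ)) s :=
        (hasDerivAt_const s x).prodMk (hasDerivAt_id s)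
      exact ((hK1.differentiable one_ne_zero) (x, s)).hasFDerivAt.comp_hasDerivAt s h1
    rw [← integral_Iic_eq_integral_Iio]
    have h0 : Tendsto (fun s => K (x, s)) atBot (𝓝 0) :=
      (hKc.comp_isClosedEmbedding hs).is_zero_at_infty.mono_left atBot_le_cocompact
    have := integral_Iic_of_hasDerivAt_of_tendsto (a := (0 : ℝ))
      (hd 0).continuousAt.continuousWithinAt (fun s _ => hd s) ?_ h0
    · simpa using this
    · exact (((hint _).comp (by fun_prop)).integrable_of_hasCompactSupport
        ((hcs (0, 1)).comp_isClosedEmbedding hs)).integrableOn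
  simp only [z1, integral_zero, integral_const_mul, zero_add, z2]
  rfl

end Divergence

/-! ### Surface measure of a graph. -/

section GraphSurface

variable {n : ℕ}
  (φ : EuclideanSpace ℝ (Fin (n + 1)) ≃ᵃⁱ[ℝ] EuclideanSpace ℝ (Fin (n + 1)))
  {γ : EuclideanSpace ℝ (Fin n) → ℝ}

lemma hasFDerivAt_graphParam_zero (hγ : ContDiff ℝ 1 γ) (x : EuclideanSpace ℝ (Fin n)) :
    HasFDerivAt (fun x => graphParam φ γ (x, 0))
      ((φ.symm.linearIsometryEquiv.toContinuousLinearEquiv :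
          EuclideanSpace ℝ (Fin (n + 1)) →L[ℝ] EuclideanSpace ℝ (Fin (n + 1))) ∘L
        (snocEquiv n : EuclideanSpace ℝ (Fin n) × ℝ →L[ℝ] EuclideanSpace ℝ (Fin (n + 1))) ∘L
        (ContinuousLinearMap.id ℝ _).prod (fderiv ℝ γ x)) x := by
  have h := (hasFDerivAt_graphParam φ hγ (x, 0)).comp x
    (hasFDerivAt_prodMk_left (𝕜 := ℝ) x (0 : ℝ))
  refine h.congr_fderiv ?_
  ext v : 1
  simp

lemma fderiv_graphParam_zero_apply (hγ : ContDiff ℝ 1 γ) (x v : EuclideanSpace ℝ (Fin n)) :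
    fderiv ℝ (fun x => graphParam φ γ (x, 0)) x v =
      φ.symm.linearIsometryEquiv (snocEquiv n (v, fderiv ℝ γ x v)) := by
  rw [(hasFDerivAt_graphParam_zero φ hγ x).fderiv]
  rfl

lemma inner_fderiv_graphParam_zero (hγ : ContDiff ℝ 1 γ) (x v w : EuclideanSpace ℝ (Fin n)) :
    inner ℝ (fderiv ℝ (fun x => graphParam φ γ (x, 0)) x v)
      (fderiv ℝ (fun x => graphParam φ γ (x, 0)) x w) =
      inner ℝ v w + fderiv ℝ γ x v * fderiv ℝ γ x w := by
  rw [fderiv_graphParam_zero_apply φ hγ, fderiv_graphParam_zero_apply φ hγ,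
    LinearIsometryEquiv.inner_map_map, inner_snocEquiv]

/-- The surface density of the graph of `γ`. -/
noncomputable def graphDensity (γ : EuclideanSpace ℝ (Fin n) → ℝ) (x : EuclideanSpace ℝ (Fin n)) :
    ℝ :=
  √(1 + ‖gradient γ x‖ ^ 2)

lemma graphDensity_pos (x : EuclideanSpace ℝ (Fin n)) : 0 < graphDensity γ x :=
  Real.sqrt_pos.2 (by positivity)

lemma fderiv_eq_inner_gradient (x v : EuclideanSpace ℝ (Fin n)) :
    fderiv ℝ γ x v = inner ℝ (gradient γ x) v := by
  rw [gradient, InnerProductSpace.toDual_symm_apply]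

lemma continuous_gradient (hγ : ContDiff ℝ 1 γ) : Continuous (gradient γ) :=
  (InnerProductSpace.toDual ℝ (EuclideanSpace ℝ (Fin n))).symm.continuous.comp
    (hγ.continuous_fderiv one_ne_zero)

lemma continuous_graphDensity (hγ : ContDiff ℝ 1 γ) : Continuous (graphDensity γ) :=
  Real.continuous_sqrt.comp (continuous_const.add ((continuous_gradient hγ).norm.pow 2))

/-- The Gram matrix of the differential is 1 + ∇γ ∇γᵀ, a rank-one perturbation of the identity with
determinant 1 + |∇γ|². -/
lemma normDet_fderiv_graphParam (hγ : ContDiff ℝ 1 γ) (x : EuclideanSpace ℝ (Fin n)) :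
    (fderiv ℝ (fun x => graphParam φ γ (x, 0)) x).toLinearMap.normDet = graphDensity γ x := by
  set A := fderiv ℝ (fun x => graphParam φ γ (x, 0)) x with hA
  set b := EuclideanSpace.basisFun (Fin n) ℝ
  have h := A.toLinearMap.normDet_sq_eq_det_gram b
  have hg : Matrix.gram ℝ (fun i => A.toLinearMap (b i)) =
      1 + Matrix.replicateCol Unit (fun i => gradient γ x i) *
        Matrix.replicateRow Unit (fun i => gradient γ x i) := by
    ext i j
    simp only [Matrix.gram_apply, ContinuousLinearMap.coe_coe, hA,
      inner_fderiv_graphParam_zero φ hγ, fderiv_eq_inner_gradient]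
    have hgi : ∀ i, gradient γ x i = fderiv ℝ γ x (EuclideanSpace.single i 1) := fun i => by
      rw [fderiv_eq_inner_gradient, EuclideanSpace.inner_single_right]
      simp
    simp [Matrix.mul_apply, Matrix.one_apply, b, EuclideanSpace.basisFun_apply, hgi,
      EuclideanSpace.inner_single_right, eq_comm]
  rw [hg, Matrix.det_one_add_replicateCol_mul_replicateRow] at h
  simp only [RCLike.ofReal_real_eq_id, id_eq] at h
  rw [graphDensity, ← Real.sqrt_sq (LinearMap.normDet_nonneg _), h, EuclideanSpace.norm_sq_eq]
  simp [dotProduct, sq]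

lemma isClosedEmbedding_graphParam_zero (hγ : ContDiff ℝ 1 γ) :
    IsClosedEmbedding fun x => graphParam φ γ (x, 0) :=
  (graphHomeomorph φ hγ).isClosedEmbedding.comp
    ⟨isEmbedding_prodMkLeft 0, by
      have : range (fun x : EuclideanSpace ℝ (Fin n) => (x, (0 : ℝ))) = univ ×ˢ {0} := by
        ext p; simp [Prod.ext_iff, eq_comm]
      rw [this]
      exact isClosed_univ.prod isClosed_singleton⟩

/-- The area formula applies since the squared length of the image of v under the differential is
‖v‖² + (Dγ v)². -/
lemma restrict_range_graphParam (hγ : ContDiff ℝ 1 γ) :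
    (Measure.euclideanHausdorffMeasure n).restrict (range fun x => graphParam φ γ (x, 0)) =
      (volume.withDensity fun x => ENNReal.ofReal (graphDensity γ x)).map
        fun x => graphParam φ γ (x, 0) := by
  have hemb := (isClosedEmbedding_graphParam_zero φ hγ).measurableEmbedding
  have hsm : ContDiff ℝ 1 fun x => graphParam φ γ (x, 0) :=
    (contDiff_graphParam φ hγ).comp (contDiff_id.prodMk contDiff_const)
  rw [← hemb.map_comap, comap_euclideanHausdorffMeasure hsm hemb]
  · simp only [normDet_fderiv_graphParam φ hγ]
  · intro x v
    refine abs_le_of_sq_le_sq' ?_ (norm_nonneg _) |>.2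
    rw [← real_inner_self_eq_norm_sq, ← real_inner_self_eq_norm_sq,
      inner_fderiv_graphParam_zero φ hγ]
    nlinarith [mul_self_nonneg (fderiv ℝ γ x v)]

lemma integral_range_graphParam (hγ : ContDiff ℝ 1 γ) (w : EuclideanSpace ℝ (Fin (n + 1)) → ℝ) :
    ∫ y in range (fun x => graphParam φ γ (x, 0)), w y ∂(Measure.euclideanHausdorffMeasure n) =
      ∫ x, graphDensity γ x * w (graphParam φ γ (x, 0)) := by
  have hemb := (isClosedEmbedding_graphParam_zero φ hγ).measurableEmbedding
  rw [restrict_range_graphParam φ hγ, hemb.integral_map,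
    integral_withDensity_eq_integral_toReal_smul
      (continuous_graphDensity hγ).measurable.ennreal_ofReal (by simp)]
  simp [ENNReal.toReal_ofReal (graphDensity_pos _).le]

lemma integrableOn_range_graphParam (hγ : ContDiff ℝ 1 γ)
    {w : EuclideanSpace ℝ (Fin (n + 1)) → ℝ} :
    IntegrableOn w (range fun x => graphParam φ γ (x, 0)) (Measure.euclideanHausdorffMeasure n) ↔
      Integrable fun x => graphDensity γ x * w (graphParam φ γ (x, 0)) := by
  have hemb := (isClosedEmbedding_graphParam_zero φ hγ).measurableEmbedding
  rw [IntegrableOn, restrict_range_graphParam φ hγ, hemb.integrable_map_iff,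
    integrable_withDensity_iff_integrable_smul'
      (continuous_graphDensity hγ).measurable.ennreal_ofReal (by simp)]
  simp [ENNReal.toReal_ofReal (graphDensity_pos _).le]

end GraphSurface

/-! ### Frontier and outward normal in a chart. -/

section LocalChart

variable {n : ℕ} {Ω : Set (EuclideanSpace ℝ (Fin (n + 1)))}

/-- On the open set `B`, the set `Ω` is the region strictly below the graph of `γ`, after the rigid
motion `φ`. -/
def IsGraphChart (Ω B : Set (EuclideanSpace ℝ (Fin (n + 1))))
    (φ : EuclideanSpace ℝ (Fin (n + 1)) ≃ᵃⁱ[ℝ] EuclideanSpace ℝ (Fin (n + 1)))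
    (γ : EuclideanSpace ℝ (Fin n) → ℝ) : Prop :=
  IsOpen B ∧ ContDiff ℝ 1 γ ∧ ∀ y ∈ B, y ∈ Ω ↔ (graphCoord φ γ y).2 < 0

lemma IsBoundedC1Domain.exists_isGraphChart (hΩ : IsBoundedC1Domain Ω)
    {z : EuclideanSpace ℝ (Fin (n + 1))} (hz : z ∈ frontier Ω) :
    ∃ r : ℝ, 0 < r ∧ ∃ φ γ, IsGraphChart Ω (Metric.ball z r) φ γ := by
  obtain ⟨r, hr, φ, γ, hγ, h⟩ := hΩ.2.2.2 z hz
  refine ⟨r, hr, φ, γ, Metric.isOpen_ball, hγ, fun y hy => ?_⟩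
  rw [h y hy, graphCoord, sub_neg]
  rfl

variable {B : Set (EuclideanSpace ℝ (Fin (n + 1)))}
  {φ : EuclideanSpace ℝ (Fin (n + 1)) ≃ᵃⁱ[ℝ] EuclideanSpace ℝ (Fin (n + 1))}
  {γ : EuclideanSpace ℝ (Fin n) → ℝ}

/-- Frontiers are local on the open set `B`, and the height over the graph is continuous and open,
so taking preimages under it commutes with `frontier`. -/
lemma IsGraphChart.mem_frontier_iff (h : IsGraphChart Ω B φ γ)
    {y : EuclideanSpace ℝ (Fin (n + 1))} (hy : y ∈ B) :
    y ∈ frontier Ω ↔ (graphCoord φ γ y).2 = 0 := by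
  obtain ⟨hB, hγ, hx⟩ := h
  set u : EuclideanSpace ℝ (Fin (n + 1)) → ℝ := fun y => (graphCoord φ γ y).2 with hu
  have h1 : Ω ∩ B = u ⁻¹' Iio 0 ∩ B := by
    ext y
    simp only [mem_inter_iff, and_congr_left_iff]
    exact fun hy => hx y hy
  have ho : IsOpenMap u := isOpenMap_snd.comp (graphHomeomorph φ hγ).symm.isOpenMap
  have hc : Continuous u := (contDiff_graphCoord φ hγ).continuous.snd
  have h2 : y ∈ frontier Ω ∩ B ↔ y ∈ frontier (u ⁻¹' Iio 0) ∩ B := by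
    rw [← frontier_inter_open_inter hB, h1, frontier_inter_open_inter hB]
  rw [← ho.preimage_frontier_eq_frontier_preimage hc, frontier_Iio] at h2
  simpa [hy] using h2

lemma hasGradientAt_graphCoord_snd (hγ : ContDiff ℝ 1 γ) (y : EuclideanSpace ℝ (Fin (n + 1))) :
    HasGradientAt (fun y => (graphCoord φ γ y).2)
      (φ.linearIsometryEquiv.symm (snocEquiv n (-gradient γ (graphCoord φ γ y).1, 1))) y := by
  rw [hasGradientAt_iff_hasFDerivAt]
  have h1 : HasFDerivAt (fun y => (snocEquiv n).symm (φ y)) _ y :=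
    (snocEquiv n).symm.hasFDerivAt.comp y (hasFDerivAt_affineIsometryEquiv φ y)
  have h2 := h1.snd.sub
    (((hγ.differentiable one_ne_zero) ((snocEquiv n).symm (φ y)).1).hasFDerivAt.comp y h1.fst)
  refine h2.congr_fderiv ?_
  ext v : 1
  obtain ⟨p, hp⟩ := (snocEquiv n).surjective (φ.linearIsometryEquiv v)
  have hv : v = φ.linearIsometryEquiv.symm (snocEquiv n p) := by
    rw [hp, LinearIsometryEquiv.symm_apply_apply]
  rw [InnerProductSpace.toDual_apply_apply, hv, LinearIsometryEquiv.inner_map_map, inner_snocEquiv,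
    inner_neg_left, ← fderiv_eq_inner_gradient]
  simp [graphCoord]
  ring

/-- The height over the graph is itself an admissible defining function, and the normal is unique.
-/
lemma IsGraphChart.outwardNormal_eq (h : IsGraphChart Ω B φ γ)
    {y : EuclideanSpace ℝ (Fin (n + 1))} (hy : y ∈ B) (hyf : y ∈ frontier Ω)
    (hn : IsOutwardUnitNormal Ω y (outwardNormal Ω y)) :
    outwardNormal Ω y = (graphDensity γ (graphCoord φ γ y).1)⁻¹ •
      φ.linearIsometryEquiv.symm (snocEquiv n (-gradient γ (graphCoord φ γ y).1, 1)) := by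
  have hg := hasGradientAt_graphCoord_snd (φ := φ) h.2.1 y
  have hnorm : ‖φ.linearIsometryEquiv.symm (snocEquiv n (-gradient γ (graphCoord φ γ y).1, 1))‖ =
      graphDensity γ (graphCoord φ γ y).1 := by
    rw [LinearIsometryEquiv.norm_map, graphDensity, ← Real.sqrt_sq (norm_nonneg _),
      norm_sq_snocEquiv, norm_neg, one_pow, add_comm]
  refine hn.unique ⟨fun y => (graphCoord φ γ y).2, (contDiff_graphCoord φ h.2.1).snd.contDiffAt,
    (h.mem_frontier_iff hy).1 hyf, ?_, ?_, ?_⟩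
  · rw [hg.gradient, ← norm_ne_zero_iff, hnorm]
    exact (graphDensity_pos _).ne'
  · filter_upwards [h.1.mem_nhds hy] with x hx using h.2.2 x hx
  · rw [hg.gradient, hnorm]

/-- The second factor is the coefficient in `setIntegral_fderiv_graphParam`; the first will cancel
against the surface density. -/
lemma inner_outwardNormal (v : EuclideanSpace ℝ (Fin (n + 1))) (x : EuclideanSpace ℝ (Fin n)) :
    inner ℝ ((graphDensity γ x)⁻¹ •
      φ.linearIsometryEquiv.symm (snocEquiv n (-gradient γ x, 1))) v =
      (graphDensity γ x)⁻¹ * ((graphVec φ v).2 - fderiv ℝ γ x (graphVec φ v).1) := by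
  obtain ⟨p, hp⟩ := (snocEquiv n).surjective (φ.linearIsometryEquiv v)
  have hv : v = φ.linearIsometryEquiv.symm (snocEquiv n p) := by
    rw [hp, LinearIsometryEquiv.symm_apply_apply]
  rw [real_inner_smul_left, hv, LinearIsometryEquiv.inner_map_map, inner_snocEquiv,
    inner_neg_left, ← fderiv_eq_inner_gradient, graphVec, LinearIsometryEquiv.apply_symm_apply,
    ContinuousLinearEquiv.symm_apply_apply]
  ring

end LocalChart

/-! ### Divergence theorem on a bounded C¹-domain. -/

section DivergenceTheorem

variable {n : ℕ} {Ω B : Set (EuclideanSpace ℝ (Fin (n + 1)))}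
  {φ : EuclideanSpace ℝ (Fin (n + 1)) ≃ᵃⁱ[ℝ] EuclideanSpace ℝ (Fin (n + 1))}
  {γ : EuclideanSpace ℝ (Fin n) → ℝ}
  {g : EuclideanSpace ℝ (Fin (n + 1)) → ℝ}

lemma range_graphParam_zero :
    range (fun x => graphParam φ γ (x, 0)) = {y | (graphCoord φ γ y).2 = 0} := by
  ext y
  constructor
  · rintro ⟨x, rfl⟩
    simp
  · intro hy
    refine ⟨(graphCoord φ γ y).1, ?_⟩
    have : ((graphCoord φ γ y).1, (0 : ℝ)) = graphCoord φ γ y := Prod.ext rfl hy.symm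
    simp only [this, graphParam_graphCoord]

lemma ContDiff.integrable_fderiv_apply (hg : ContDiff ℝ 1 g) (hc : HasCompactSupport g)
    (v : EuclideanSpace ℝ (Fin (n + 1))) : Integrable fun x => fderiv ℝ g x v :=
  ((hg.continuous_fderiv one_ne_zero).clm_apply continuous_const).integrable_of_hasCompactSupport
    (hc.fderiv_apply (𝕜 := ℝ) v)

lemma IsGraphChart.setIntegral_fderiv (h : IsGraphChart Ω B φ γ) (hΩ : MeasurableSet Ω)
    (hn : ∀ y ∈ frontier Ω, IsOutwardUnitNormal Ω y (outwardNormal Ω y))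
    (hg : ContDiff ℝ 1 g) (hc : HasCompactSupport g) (hB : tsupport g ⊆ B)
    (v : EuclideanSpace ℝ (Fin (n + 1))) :
    IntegrableOn (fun y => g y * inner ℝ (outwardNormal Ω y) v) (frontier Ω)
      (Measure.euclideanHausdorffMeasure n) ∧
    ∫ y in Ω, fderiv ℝ g y v = ∫ y in frontier Ω, g y * inner ℝ (outwardNormal Ω y) v
      ∂(Measure.euclideanHausdorffMeasure n) := by
  have hγ := h.2.1
  set a : EuclideanSpace ℝ (Fin n) → ℝ :=
    fun x => (graphVec φ v).2 - fderiv ℝ γ x (graphVec φ v).1 with ha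
  have hac : Continuous a :=
    continuous_const.sub ((hγ.continuous_fderiv one_ne_zero).clm_apply continuous_const)
  -- The boundary integrand continued to the whole graph. Frontier and graph may differ outside `B`,
  -- but `g` vanishes there.
  set w : EuclideanSpace ℝ (Fin (n + 1)) → ℝ := fun y =>
    g y * ((graphDensity γ (graphCoord φ γ y).1)⁻¹ * a (graphCoord φ γ y).1) with hw
  have hemb := isClosedEmbedding_graphParam_zero φ hγ
  have hfr : (frontier Ω).indicator (fun y => g y * inner ℝ (outwardNormal Ω y) v) =
      (range fun x => graphParam φ γ (x, 0)).indicator w := by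
    funext y
    by_cases hy : y ∈ B
    · have hiff := h.mem_frontier_iff hy
      by_cases hyf : y ∈ frontier Ω
      · rw [indicator_of_mem hyf, indicator_of_mem (by
          rw [range_graphParam_zero]; exact hiff.1 hyf), h.outwardNormal_eq hy hyf (hn y hyf),
          inner_outwardNormal]
      · rw [indicator_of_notMem hyf, indicator_of_notMem (by
          rw [range_graphParam_zero]; exact fun hh => hyf (hiff.2 hh))]
    · have : g y = 0 := image_eq_zero_of_notMem_tsupport fun hh => hy (hB hh)
      rw [indicator_apply_eq_zero.2 fun _ => by simp [this],
        indicator_apply_eq_zero.2 fun _ => by simp [hw, this]]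
  have hwd : ∀ x, graphDensity γ x * w (graphParam φ γ (x, 0)) =
      a x * g (graphParam φ γ (x, 0)) := by
    intro x
    have := (graphDensity_pos (γ := γ) x).ne'
    simp only [hw, graphCoord_graphParam]
    field_simp
  have hmf : MeasurableSet (frontier Ω) := isClosed_frontier.measurableSet
  have hmr : MeasurableSet (range fun x => graphParam φ γ (x, 0)) :=
    hemb.isClosed_range.measurableSet
  refine ⟨?_, ?_⟩
  · rw [← integrable_indicator_iff hmf, hfr, integrable_indicator_iff hmr,
      integrableOn_range_graphParam φ hγ]
    simp only [hwd]
    exact (hac.mul (hg.continuous.comp hemb.continuous)).integrable_of_hasCompactSupport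
      (hc.comp_isClosedEmbedding hemb).mul_left
  · rw [← integral_indicator hmf, hfr, integral_indicator hmr, integral_range_graphParam φ hγ]
    simp only [hwd]
    rw [← setIntegral_fderiv_graphParam φ hγ hg hc v]
    set U : Set (EuclideanSpace ℝ (Fin (n + 1))) := {y | (graphCoord φ γ y).2 < 0} with hU
    have hUm : MeasurableSet U :=
      (isOpen_lt (contDiff_graphCoord φ hγ).continuous.snd continuous_const).measurableSet
    have hin : Ω.indicator (fun y => fderiv ℝ g y v) = U.indicator fun y => fderiv ℝ g y v := by
      funext y
      by_cases hy : y ∈ B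
      · have := h.2.2 y hy
        by_cases hyΩ : y ∈ Ω
        · rw [indicator_of_mem hyΩ, indicator_of_mem (show y ∈ U from this.1 hyΩ)]
        · rw [indicator_of_notMem hyΩ, indicator_of_notMem (show y ∉ U from fun hh => hyΩ (this.2 hh))]
      · have : fderiv ℝ g y = 0 := by
          have h1 : y ∉ tsupport (fderiv ℝ g) := fun hh => hy (hB (tsupport_fderiv_subset ℝ hh))
          exact image_eq_zero_of_notMem_tsupport h1
        rw [indicator_apply_eq_zero.2 fun _ => by simp [this],
          indicator_apply_eq_zero.2 fun _ => by simp [this]]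
    rw [← integral_indicator hΩ, hin, integral_indicator hUm,
      ← (measurePreserving_graphParam φ hγ).setIntegral_preimage_emb
        (measurableEmbedding_graphParam φ hγ)]
    simp [hU]

/-- The interior piece of the partition of unity, for which both sides are zero. -/
lemma setIntegral_fderiv_of_tsupport_subset (hΩo : IsOpen Ω)
    (hg : ContDiff ℝ 1 g) (hc : HasCompactSupport g) (hB : tsupport g ⊆ Ω)
    (v : EuclideanSpace ℝ (Fin (n + 1))) :
    IntegrableOn (fun y => g y * inner ℝ (outwardNormal Ω y) v) (frontier Ω)
      (Measure.euclideanHausdorffMeasure n) ∧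
    ∫ y in Ω, fderiv ℝ g y v = ∫ y in frontier Ω, g y * inner ℝ (outwardNormal Ω y) v
      ∂(Measure.euclideanHausdorffMeasure n) := by
  have h0 : ∀ y ∈ frontier Ω, g y * inner ℝ (outwardNormal Ω y) v = 0 := by
    intro y hy
    have : y ∉ tsupport g := fun hh => by
      rw [hΩo.frontier_eq] at hy
      exact hy.2 (hB hh)
    rw [image_eq_zero_of_notMem_tsupport this, zero_mul]
  refine ⟨(integrableOn_congr_fun h0 isClosed_frontier.measurableSet).2 integrableOn_zero, ?_⟩
  rw [setIntegral_congr_fun isClosed_frontier.measurableSet h0, integral_zero,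
    setIntegral_eq_integral_of_forall_compl_eq_zero,
    HasCompactSupport.integral_fderiv_apply_eq_zero volume hg hc v]
  intro y hy
  have h1 : y ∉ tsupport (fderiv ℝ g) := fun hh => hy (hB (tsupport_fderiv_subset ℝ hh))
  rw [image_eq_zero_of_notMem_tsupport h1, zero_apply]

open scoped Manifold ContDiff in
/-- **Divergence theorem** on a bounded `C¹`-domain, in directional form. -/
theorem IsBoundedC1Domain.setIntegral_fderiv (hΩ : IsBoundedC1Domain Ω)
    (hg : ContDiff ℝ 1 g) (hc : HasCompactSupport g) (v : EuclideanSpace ℝ (Fin (n + 1))) :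
    IntegrableOn (fun y => g y * inner ℝ (outwardNormal Ω y) v) (frontier Ω)
      (Measure.euclideanHausdorffMeasure n) ∧
    ∫ y in Ω, fderiv ℝ g y v = ∫ y in frontier Ω, g y * inner ℝ (outwardNormal Ω y) v
      ∂(Measure.euclideanHausdorffMeasure n) := by
  classical
  have hΩo := hΩ.1
  have hcomp : IsCompact (frontier Ω) :=
    Metric.isCompact_of_isClosed_isBounded isClosed_frontier
      (hΩ.2.2.1.closure.subset frontier_subset_closure)
  choose! r hr φ γ hchart using fun z (hz : z ∈ frontier Ω) => hΩ.exists_isGraphChart hz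
  obtain ⟨t, ht, hcov⟩ := hcomp.elim_nhds_subcover (fun z => Metric.ball z (r z))
    (fun z hz => Metric.ball_mem_nhds z (hr z hz))
  -- The cover of the closure: `none` indexes Ω itself, `some z` the chart ball around z.
  let U : Option t → Set (EuclideanSpace ℝ (Fin (n + 1))) := fun i =>
    i.elim Ω fun z => Metric.ball z.1 (r z.1)
  have hUo : ∀ i, IsOpen (U i) := by
    rintro (_ | z)
    exacts [hΩo, Metric.isOpen_ball]
  have hUc : closure Ω ⊆ ⋃ i, U i := by
    intro y hy
    by_cases hyΩ : y ∈ Ω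
    · exact mem_iUnion.2 ⟨none, hyΩ⟩
    · obtain ⟨z, hz, hyz⟩ := mem_iUnion₂.1 (hcov (by
        rw [hΩo.frontier_eq]; exact ⟨hy, hyΩ⟩))
      exact mem_iUnion.2 ⟨some ⟨z, hz⟩, hyz⟩
  obtain ⟨f, hf⟩ := SmoothPartitionOfUnity.exists_isSubordinate
    𝓘(ℝ, EuclideanSpace ℝ (Fin (n + 1))) isClosed_closure U hUo hUc
  have hsum : ∀ y ∈ closure Ω, ∑ i, f i y * g y = g y := by
    intro y hy
    have := f.sum_eq_one hy
    rw [finsum_eq_sum_of_fintype] at this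
    rw [← Finset.sum_mul, this, one_mul]
  have hfg : ∀ i, ContDiff ℝ 1 fun y => f i y * g y := fun i =>
    ((f i).contMDiff.contDiff.of_le (by simp)).mul hg
  have hfc : ∀ i, HasCompactSupport fun y => f i y * g y := fun i => hc.mul_left
  have hloc : ∀ i, IntegrableOn (fun y => f i y * g y * inner ℝ (outwardNormal Ω y) v) (frontier Ω)
      (Measure.euclideanHausdorffMeasure n) ∧
      ∫ y in Ω, fderiv ℝ (fun y => f i y * g y) y v =
        ∫ y in frontier Ω, f i y * g y * inner ℝ (outwardNormal Ω y) v
        ∂(Measure.euclideanHausdorffMeasure n) := by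
    intro i
    have hsub : tsupport (fun y => f i y * g y) ⊆ U i :=
      (tsupport_mul_subset_left).trans (hf i)
    rcases i with _ | z
    · exact setIntegral_fderiv_of_tsupport_subset hΩo (hfg _) (hfc _) hsub v
    · exact (hchart z.1 (ht z.1 z.2)).setIntegral_fderiv hΩo.measurableSet
        (fun y hy => hΩ.outwardNormal_spec hy) (hfg _) (hfc _) hsub v
  have hfr : ∀ y ∈ frontier Ω, ∑ i, f i y * g y * inner ℝ (outwardNormal Ω y) v =
      g y * inner ℝ (outwardNormal Ω y) v := by
    intro y hy
    rw [← Finset.sum_mul, hsum y (frontier_subset_closure hy)]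
  have hin : ∀ y ∈ Ω, ∑ i, fderiv ℝ (fun y => f i y * g y) y v = fderiv ℝ g y v := by
    intro y hy
    -- The partition sums to 1 only on the closure of Ω; since Ω is open, this still determines
    -- derivatives at its points.
    have h1 : (fun y => ∑ i, f i y * g y) =ᶠ[𝓝 y] g := by
      filter_upwards [hΩo.mem_nhds hy] with x hx using hsum x (subset_closure hx)
    rw [← h1.fderiv_eq, fderiv_fun_sum fun i _ => ((hfg i).differentiable one_ne_zero) y]
    simp
  have hmf : MeasurableSet (frontier Ω) := isClosed_frontier.measurableSet
  refine ⟨(integrableOn_congr_fun hfr hmf).1 (integrable_finsetSum _ fun i _ => (hloc i).1), ?_⟩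
  rw [← setIntegral_congr_fun hmf hfr, ← setIntegral_congr_fun hΩo.measurableSet hin,
    integral_finsetSum _ fun i _ => (hloc i).1,
    integral_finsetSum _ fun i _ => ((hfg i).integrable_fderiv_apply (hfc i) v).integrableOn]
  exact Finset.sum_congr rfl fun i _ => (hloc i).2

/-- **Divergence theorem** on a bounded `C¹`-domain. -/
theorem IsBoundedC1Domain.sum_setIntegral_fderiv (hΩ : IsBoundedC1Domain Ω)
    {G : EuclideanSpace ℝ (Fin (n + 1)) → EuclideanSpace ℝ (Fin (n + 1))}
    (hG : ContDiff ℝ 1 G) (hc : HasCompactSupport G) :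
    IntegrableOn (fun y => inner ℝ (G y) (outwardNormal Ω y)) (frontier Ω)
      (Measure.euclideanHausdorffMeasure n) ∧
    ∑ i, ∫ y in Ω, fderiv ℝ G y (EuclideanSpace.single i 1) i =
      ∫ y in frontier Ω, inner ℝ (G y) (outwardNormal Ω y)
        ∂(Measure.euclideanHausdorffMeasure n) := by
  have hGi : ∀ i, ContDiff ℝ 1 fun y => G y i := fun i => contDiff_euclidean.1 hG i
  have hGc : ∀ i, HasCompactSupport fun y => G y i := fun i =>
    hc.comp_left (g := fun x : EuclideanSpace ℝ (Fin (n + 1)) => x i) (by simp)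
  have h := fun i => hΩ.setIntegral_fderiv (hGi i) (hGc i) (EuclideanSpace.single i 1)
  have hfr : ∀ y, ∑ i, G y i * inner ℝ (outwardNormal Ω y) (EuclideanSpace.single i (1 : ℝ)) =
      inner ℝ (G y) (outwardNormal Ω y) := by
    intro y
    simp [PiLp.inner_apply, mul_comm]
  have hd : ∀ i y, fderiv ℝ (fun y => G y i) y (EuclideanSpace.single i 1) =
      fderiv ℝ G y (EuclideanSpace.single i 1) i := by
    intro i y
    have h1 := (EuclideanSpace.proj (𝕜 := ℝ) i).hasFDerivAt.comp y
      ((hG.differentiable one_ne_zero) y).hasFDerivAt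
    have h2 : HasFDerivAt (fun y => G y i) _ y := h1
    rw [h2.fderiv]
    rfl
  simp only [hd] at h
  constructor
  · have := integrable_finsetSum Finset.univ fun i _ => (h i).1
    simp only [hfr] at this
    exact this
  · rw [Finset.sum_congr rfl fun i _ => (h i).2, ← integral_finsetSum _ fun i _ => (h i).1]
    simp only [hfr]

end DivergenceTheorem

/-! ### Volume of the points that a translation moves out of Ω. -/

section Translation

variable {n : ℕ} {Ω : Set (EuclideanSpace ℝ (Fin (n + 1)))}

/-- Otherwise the interior and the exterior of `u` would disconnect `s`. Applied to segments that
leave Ω. -/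
lemma IsPreconnected.exists_mem_frontier {X : Type*} [TopologicalSpace X] {s u : Set X}
    (hs : IsPreconnected s) {x y : X} (hx : x ∈ s) (hxu : x ∈ u) (hy : y ∈ s) (hyu : y ∉ u) :
    ∃ z ∈ s, z ∈ frontier u := by
  by_contra! hcon
  have h1 : x ∈ interior u := by
    by_contra hh
    exact hcon x hx ⟨subset_closure hxu, hh⟩
  have h2 : y ∈ (closure u)ᶜ := fun hh => hcon y hy ⟨hh, fun h => hyu (interior_subset h)⟩
  obtain ⟨z, -, hz1, hz2⟩ := hs (interior u) (closure u)ᶜ isOpen_interior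
    isClosed_closure.isOpen_compl (fun z hz => by
      by_cases hzc : z ∈ closure u
      · exact Or.inl (by_contra fun hh => hcon z hz ⟨hzc, hh⟩)
      · exact Or.inr hzc) ⟨x, hx, h1⟩ ⟨y, hy, h2⟩
  exact hz2 (interior_subset_closure hz1)

/-- The height is Lipschitz on the ball with some constant K, so an exiting point has height in
[-K‖v‖, 0]. In the volume-preserving graph coordinates such points lie in a slab of thickness K‖v‖
over a bounded base. Half the radius keeps x + v in the chart. -/
lemma IsGraphChart.exists_volume_le {z : EuclideanSpace ℝ (Fin (n + 1))} {r : ℝ}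
    {φ : EuclideanSpace ℝ (Fin (n + 1)) ≃ᵃⁱ[ℝ] EuclideanSpace ℝ (Fin (n + 1))}
    {γ : EuclideanSpace ℝ (Fin n) → ℝ} (h : IsGraphChart Ω (Metric.ball z r) φ γ) :
    ∃ C : ℝ, 0 ≤ C ∧ ∀ v : EuclideanSpace ℝ (Fin (n + 1)), ‖v‖ < r / 2 →
      volume {x | x ∈ Metric.ball z (r / 2) ∧ x ∈ Ω ∧ x + v ∉ Ω} ≤ ENNReal.ofReal (C * ‖v‖) := by
  obtain ⟨hB, hγ, hx⟩ := h
  have hcd := contDiff_graphCoord φ hγ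
  obtain ⟨K, hK⟩ := (hcd.snd.locallyLipschitz.locallyLipschitzOn
    (s := Metric.closedBall z r)).exists_lipschitzOnWith_of_compact (isCompact_closedBall _ _)
  have hbd : Bornology.IsBounded ((fun y => (graphCoord φ γ y).1) '' Metric.closedBall z r) :=
    ((isCompact_closedBall _ _).image hcd.fst.continuous).isBounded
  obtain ⟨R, hR⟩ := hbd.subset_closedBall 0
  refine ⟨(volume (Metric.closedBall (0 : EuclideanSpace ℝ (Fin n)) R)).toReal * K,
    by positivity, fun v hv => ?_⟩
  have hsub : {x | x ∈ Metric.ball z (r / 2) ∧ x ∈ Ω ∧ x + v ∉ Ω} ⊆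
      graphCoord φ γ ⁻¹' (Metric.closedBall 0 R ×ˢ Icc (-(K * ‖v‖)) 0) := by
    rintro x ⟨hxb, hxΩ, hxv⟩
    have hx2 : x + v ∈ Metric.ball z r := by
      rw [Metric.mem_ball] at hxb ⊢
      calc dist (x + v) z ≤ dist (x + v) x + dist x z := dist_triangle _ _ _
        _ < r / 2 + r / 2 := by
          refine add_lt_add ?_ hxb
          simpa [dist_eq_norm] using hv
        _ = r := by ring
    have hx1 : x ∈ Metric.ball z r :=
      Metric.ball_subset_ball (by linarith [norm_nonneg v]) hxb
    have h1 := (hx x hx1).1 hxΩ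
    have h2 : 0 ≤ (graphCoord φ γ (x + v)).2 := not_lt.1 fun hh => hxv ((hx _ hx2).2 hh)
    have h3 := hK.dist_le_mul _ (Metric.ball_subset_closedBall hx2) _
      (Metric.ball_subset_closedBall hx1)
    rw [Real.dist_eq, dist_eq_norm, add_sub_cancel_left] at h3
    have h4 := le_abs_self ((graphCoord φ γ (x + v)).2 - (graphCoord φ γ x).2)
    exact ⟨hR ⟨x, Metric.ball_subset_closedBall hx1, rfl⟩, by linarith, h1.le⟩
  have hmeas : MeasurableSet (graphCoord φ γ ⁻¹'
      (Metric.closedBall 0 R ×ˢ Icc (-(K * ‖v‖)) 0)) :=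
    (Metric.isClosed_closedBall.prod isClosed_Icc |>.preimage hcd.continuous).measurableSet
  refine (measure_mono hsub).trans ?_
  rw [← (measurePreserving_graphParam φ hγ).measure_preimage hmeas.nullMeasurableSet]
  have hpre : graphParam φ γ ⁻¹' (graphCoord φ γ ⁻¹'
      (Metric.closedBall 0 R ×ˢ Icc (-(K * ‖v‖)) 0)) =
      Metric.closedBall 0 R ×ˢ Icc (-(K * ‖v‖)) 0 := by
    ext p; simp
  rw [hpre, Measure.volume_eq_prod, Measure.prod_prod, Real.volume_Icc, mul_assoc,
    ENNReal.ofReal_mul ENNReal.toReal_nonneg, ENNReal.ofReal_toReal measure_closedBall_lt_top.ne]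
  simp

/-- The part of `Ω` that a translation by `v` moves out of `Ω` has volume `O(‖v‖)`. -/
lemma IsBoundedC1Domain.exists_volume_le (hΩ : IsBoundedC1Domain Ω) :
    ∃ C : ℝ, 0 ≤ C ∧ ∀ v : EuclideanSpace ℝ (Fin (n + 1)),
      volume {x | x ∈ Ω ∧ x + v ∉ Ω} ≤ ENNReal.ofReal (C * ‖v‖) := by
  have hcomp : IsCompact (frontier Ω) :=
    Metric.isCompact_of_isClosed_isBounded isClosed_frontier
      (hΩ.2.2.1.closure.subset frontier_subset_closure)
  choose! r hr φ γ hchart using fun z (hz : z ∈ frontier Ω) => hΩ.exists_isGraphChart hz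
  choose! C hC hCv using fun z (hz : z ∈ frontier Ω) => (hchart z hz).exists_volume_le
  -- Quarter radii: an exiting point is within ‖v‖ < r/4 of a frontier point, which is within r/4 of
  -- a centre, so it lies in the half ball.
  obtain ⟨t, ht, hcov⟩ := hcomp.elim_nhds_subcover (fun z => Metric.ball z (r z / 4))
    (fun z hz => Metric.ball_mem_nhds z (by linarith [hr z hz]))
  obtain ⟨δ, hδ, hδt⟩ : ∃ δ : ℝ, 0 < δ ∧ ∀ z ∈ t, δ < r z / 4 := by
    have h1 : ∀ᶠ δ in 𝓝[>] (0 : ℝ), ∀ z ∈ t, δ < r z / 4 :=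
      (Filter.eventually_all_finset t).2 fun z hz =>
        mem_of_superset (Ioo_mem_nhdsGT (show (0 : ℝ) < r z / 4 by linarith [hr z (ht z hz)]))
          fun δ hδ => hδ.2
    have h2 : ∀ᶠ δ in 𝓝[>] (0 : ℝ), 0 < δ := self_mem_nhdsWithin
    exact (h2.and h1).exists
  have hvol : volume Ω ≠ ⊤ := hΩ.2.2.1.measure_lt_top.ne
  have hCt : 0 ≤ ∑ z ∈ t, C z := Finset.sum_nonneg fun z hz => hC z (ht z hz)
  -- The last summand covers ‖v‖ ≥ δ, where the volume of Ω is a sufficient bound.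
  refine ⟨∑ z ∈ t, C z + (volume Ω).toReal / δ, by positivity, fun v => ?_⟩
  rcases lt_or_ge ‖v‖ δ with hv | hv
  · have hsub : {x | x ∈ Ω ∧ x + v ∉ Ω} ⊆
        ⋃ z ∈ t, {x | x ∈ Metric.ball z (r z / 2) ∧ x ∈ Ω ∧ x + v ∉ Ω} := by
      rintro x ⟨hx, hxv⟩
      obtain ⟨y, hy, hyf⟩ := (convex_segment x (x + v)).isPreconnected.exists_mem_frontier
        (left_mem_segment ℝ _ _) hx (right_mem_segment ℝ _ _) hxv
      obtain ⟨z, hz, hyz⟩ := mem_iUnion₂.1 (hcov hyf)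
      refine mem_iUnion₂.2 ⟨z, hz, ?_, hx, hxv⟩
      have h1 : dist x y ≤ ‖v‖ := by
        have := (convex_closedBall x ‖v‖).segment_subset (x := x) (y := x + v) (by simp)
          (by simp [dist_eq_norm]) hy
        rwa [Metric.mem_closedBall, dist_comm] at this
      rw [Metric.mem_ball] at hyz ⊢
      have := dist_triangle x y z
      linarith [hδt z hz]
    calc volume {x | x ∈ Ω ∧ x + v ∉ Ω}
        ≤ ∑ z ∈ t, volume {x | x ∈ Metric.ball z (r z / 2) ∧ x ∈ Ω ∧ x + v ∉ Ω} :=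
          (measure_mono hsub).trans (measure_biUnion_finset_le t _)
      _ ≤ ∑ z ∈ t, ENNReal.ofReal (C z * ‖v‖) := Finset.sum_le_sum fun z hz =>
          hCv z (ht z hz) v (by linarith [hδt z hz, hr z (ht z hz)])
      _ = ENNReal.ofReal (∑ z ∈ t, C z * ‖v‖) :=
          (ENNReal.ofReal_sum_of_nonneg fun z hz =>
            mul_nonneg (hC z (ht z hz)) (norm_nonneg v)).symm
      _ ≤ _ := by
          refine ENNReal.ofReal_le_ofReal ?_
          rw [← Finset.sum_mul, add_mul]
          have : 0 ≤ (volume Ω).toReal / δ * ‖v‖ := by positivity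
          linarith
  · calc volume {x | x ∈ Ω ∧ x + v ∉ Ω} ≤ volume Ω := measure_mono fun x hx => hx.1
      _ = ENNReal.ofReal (volume Ω).toReal := (ENNReal.ofReal_toReal hvol).symm
      _ ≤ _ := by
          refine ENNReal.ofReal_le_ofReal ?_
          have h1 : (volume Ω).toReal ≤ (volume Ω).toReal / δ * ‖v‖ := by
            rw [div_mul_eq_mul_div, le_div_iff₀ hδ]
            exact mul_le_mul_of_nonneg_left hv ENNReal.toReal_nonneg
          have h2 := mul_nonneg hCt (norm_nonneg v)
          linarith

end Translation

/-! ### Moments and concentration of radial kernels. -/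

section Kernels

variable {n : ℕ} {k : EuclideanSpace ℝ (Fin (n + 1)) → ℝ}

lemma IsRadialKernel.mul {d : ℕ} {α μ : EuclideanSpace ℝ (Fin d) → ℝ} (hα : IsRadialKernel α)
    (hμ : IsRadialKernel μ) : IsRadialKernel fun h => α h * μ h where
  aemeasurable := hα.aemeasurable.mul hμ.aemeasurable
  nonneg h hh := mul_nonneg (hα.nonneg h hh) (hμ.nonneg h hh)
  radial h h' hh hn := by rw [hα.radial h h' hh hn, hμ.radial h h' hh hn]

lemma IsRadialKernel.apply_isometry {d : ℕ} {k : EuclideanSpace ℝ (Fin d) → ℝ}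
    (hk : IsRadialKernel k) (e : EuclideanSpace ℝ (Fin d) ≃ₗᵢ[ℝ] EuclideanSpace ℝ (Fin d))
    (h : EuclideanSpace ℝ (Fin d)) : k (e h) = k h := by
  rcases eq_or_ne h 0 with rfl | hh
  · simp
  · exact (hk.radial h (e h) hh (e.norm_map h).symm).symm

/-- A radial kernel that satisfies the normalization (L1). -/
structure IsNormalizedKernel (k : EuclideanSpace ℝ (Fin (n + 1)) → ℝ) : Prop
    extends IsRadialKernel k where
  integral_eq : ∫ h, min 1 (‖h‖ ^ 2) * k h = n + 1

namespace IsNormalizedKernel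

/-- A non-integrable function has integral 0 by convention, and n + 1 ≠ 0. -/
lemma integrable (hk : IsNormalizedKernel k) : Integrable fun h => min 1 (‖h‖ ^ 2) * k h := by
  by_contra hcon
  have := hk.integral_eq
  rw [integral_undef hcon] at this
  have h1 : (0 : ℝ) < n + 1 := by positivity
  linarith

lemma min_mul_nonneg (hk : IsNormalizedKernel k) (h : EuclideanSpace ℝ (Fin (n + 1))) :
    0 ≤ min 1 (‖h‖ ^ 2) * k h := by
  rcases eq_or_ne h 0 with rfl | hh
  · simp
  · exact mul_nonneg (le_min zero_le_one (by positivity)) (hk.nonneg h hh)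

lemma abs_mul_le (hk : IsNormalizedKernel k) {f : EuclideanSpace ℝ (Fin (n + 1)) → ℝ} {C : ℝ}
    (hC : ∀ h, |f h| ≤ C * min 1 (‖h‖ ^ 2)) (h : EuclideanSpace ℝ (Fin (n + 1))) :
    ‖k h * f h‖ ≤ C * (min 1 (‖h‖ ^ 2) * k h) := by
  -- The sign of k(0) is unknown, but the bound forces f(0) = 0.
  rcases eq_or_ne h 0 with rfl | hh
  · have := hC 0
    simp only [norm_zero, ne_eq, OfNat.ofNat_ne_zero, not_false_eq_true, zero_pow, zero_le_one,
      inf_of_le_right, mul_zero, zero_mul] at this ⊢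
    rw [abs_nonpos_iff.1 this, mul_zero, norm_zero]
  · rw [norm_mul, Real.norm_eq_abs, Real.norm_eq_abs, abs_of_nonneg (hk.nonneg h hh)]
    calc k h * |f h| ≤ k h * (C * min 1 (‖h‖ ^ 2)) :=
          mul_le_mul_of_nonneg_left (hC h) (hk.nonneg h hh)
      _ = _ := by ring

/-- Functions that are `O(min 1 |h|²)` are integrable against a normalized kernel. -/
lemma integrable_mul (hk : IsNormalizedKernel k) {f : EuclideanSpace ℝ (Fin (n + 1)) → ℝ}
    (hf : AEStronglyMeasurable f) {C : ℝ} (hC : ∀ h, |f h| ≤ C * min 1 (‖h‖ ^ 2)) :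
    Integrable fun h => k h * f h :=
  (hk.integrable.const_mul C).mono' (hk.aemeasurable.aestronglyMeasurable.mul hf)
    (Eventually.of_forall (hk.abs_mul_le hC))

end IsNormalizedKernel

/-- `min 1 |h|² / |h|²` times the coordinate product `hᵢ hⱼ`. -/
noncomputable def truncMonomial (i j : Fin (n + 1)) (h : EuclideanSpace ℝ (Fin (n + 1))) : ℝ :=
  min 1 (‖h‖ ^ 2) / ‖h‖ ^ 2 * (h i * h j)

lemma abs_truncMonomial_le (i j : Fin (n + 1)) (h : EuclideanSpace ℝ (Fin (n + 1))) :
    |truncMonomial i j h| ≤ 1 * min 1 (‖h‖ ^ 2) := by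
  rcases eq_or_ne h 0 with rfl | hh
  · simp [truncMonomial]
  · have hp : 0 < ‖h‖ ^ 2 := by positivity
    have hm : 0 ≤ min 1 (‖h‖ ^ 2) := le_min zero_le_one hp.le
    have h1 : |h i| ≤ ‖h‖ := by simpa using PiLp.norm_apply_le h i
    have h2 : |h j| ≤ ‖h‖ := by simpa using PiLp.norm_apply_le h j
    have h3 : |h i * h j| ≤ ‖h‖ ^ 2 := by
      rw [abs_mul, sq]
      exact mul_le_mul h1 h2 (abs_nonneg _) (norm_nonneg _)
    rw [truncMonomial, abs_mul, abs_of_nonneg (div_nonneg hm hp.le), one_mul]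
    calc _ ≤ min 1 (‖h‖ ^ 2) / ‖h‖ ^ 2 * ‖h‖ ^ 2 :=
          mul_le_mul_of_nonneg_left h3 (div_nonneg hm hp.le)
      _ = _ := div_mul_cancel₀ _ hp.ne'

lemma measurable_truncMonomial (i j : Fin (n + 1)) :
    Measurable (truncMonomial (n := n) i j) := by
  unfold truncMonomial
  fun_prop

lemma truncMonomial_of_norm_le_one {h : EuclideanSpace ℝ (Fin (n + 1))} (hh : ‖h‖ ≤ 1)
    (i j : Fin (n + 1)) : truncMonomial i j h = h i * h j := by
  rcases eq_or_ne h 0 with rfl | h0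
  · simp [truncMonomial]
  · have hp : 0 < ‖h‖ ^ 2 := by positivity
    rw [truncMonomial, min_eq_right (pow_le_one₀ (norm_nonneg h) hh), div_self hp.ne', one_mul]

namespace IsNormalizedKernel

lemma integrable_truncMonomial (hk : IsNormalizedKernel k) (i j : Fin (n + 1)) :
    Integrable fun h => k h * truncMonomial i j h :=
  hk.integrable_mul (measurable_truncMonomial i j).aestronglyMeasurable (abs_truncMonomial_le i j)

/-- Reflecting the i-th coordinate preserves k and volume but flips the sign of the integrand. -/
lemma integral_truncMonomial_of_ne (hk : IsNormalizedKernel k) {i j : Fin (n + 1)} (hij : i ≠ j) :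
    ∫ h, k h * truncMonomial i j h = 0 := by
  classical
  set e : EuclideanSpace ℝ (Fin (n + 1)) ≃ₗᵢ[ℝ] EuclideanSpace ℝ (Fin (n + 1)) :=
    LinearIsometryEquiv.piLpCongrRight 2 fun l =>
      if l = i then LinearIsometryEquiv.neg ℝ else LinearIsometryEquiv.refl ℝ ℝ with he
  have hi : ∀ h, e h i = -h i := fun h => by simp [he]
  have hj : ∀ h, e h j = h j := fun h => by simp [he, hij.symm]
  have h1 := e.measurePreserving.integral_comp e.toHomeomorph.measurableEmbedding
    fun h => k h * truncMonomial i j h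
  have h2 : ∀ h, k (e h) * truncMonomial i j (e h) = -(k h * truncMonomial i j h) := by
    intro h
    rw [hk.apply_isometry e, truncMonomial, truncMonomial, e.norm_map, hi, hj]
    ring
  simp only [h2, integral_neg] at h1
  linarith

/-- Swapping coordinates makes the n + 1 diagonal moments equal, and they sum to ∫ min(1, |h|²) k =
n + 1. -/
lemma integral_truncMonomial_self (hk : IsNormalizedKernel k) (i : Fin (n + 1)) :
    ∫ h, k h * truncMonomial i i h = 1 := by
  have hsw : ∀ j, ∫ h, k h * truncMonomial j j h = ∫ h, k h * truncMonomial i i h := by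
    intro j
    set e : EuclideanSpace ℝ (Fin (n + 1)) ≃ₗᵢ[ℝ] EuclideanSpace ℝ (Fin (n + 1)) :=
      LinearIsometryEquiv.piLpCongrLeft 2 ℝ ℝ (Equiv.swap i j) with he
    have hi : ∀ h, e h i = h j := fun h => by
      simp [he, LinearIsometryEquiv.piLpCongrLeft_apply, Equiv.piCongrLeft'_apply]
    have h1 := e.measurePreserving.integral_comp e.toHomeomorph.measurableEmbedding
      fun h => k h * truncMonomial i i h
    rw [← h1]
    refine integral_congr_ae (Eventually.of_forall fun h => ?_)
    simp only [hk.apply_isometry e, truncMonomial, e.norm_map, hi]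
  have hsum : ∑ j, ∫ h, k h * truncMonomial j j h = n + 1 := by
    rw [← integral_finsetSum _ fun j _ => hk.integrable_truncMonomial j j, ← hk.integral_eq]
    refine integral_congr_ae (Eventually.of_forall fun h => ?_)
    simp only [truncMonomial, ← Finset.mul_sum]
    have : ∑ j, h j * h j = ‖h‖ ^ 2 := by
      rw [EuclideanSpace.norm_sq_eq]
      simp [sq]
    rw [this]
    rcases eq_or_ne h 0 with rfl | h0
    · simp
    · have hp : ‖h‖ ^ 2 ≠ 0 := by positivity
      rw [div_mul_cancel₀ _ hp, mul_comm]
  simp only [hsw, Finset.sum_const, Finset.card_univ, Fintype.card_fin, nsmul_eq_mul,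
    Nat.cast_add, Nat.cast_one] at hsum
  have h1 : (n + 1 : ℝ) ≠ 0 := by positivity
  exact mul_left_cancel₀ h1 (hsum.trans (mul_one _).symm)

lemma integral_sum_truncMonomial (hk : IsNormalizedKernel k)
    (Q : Fin (n + 1) → Fin (n + 1) → ℝ) :
    ∫ h, k h * ∑ i, ∑ j, Q i j * truncMonomial i j h = ∑ i, Q i i := by
  have h1 : ∀ h, k h * ∑ i, ∑ j, Q i j * truncMonomial i j h =
      ∑ i, ∑ j, Q i j * (k h * truncMonomial i j h) := by
    intro h
    simp only [Finset.mul_sum]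
    exact Finset.sum_congr rfl fun i _ => Finset.sum_congr rfl fun j _ => by ring
  have hint : ∀ i j, Integrable fun h => Q i j * (k h * truncMonomial i j h) := fun i j =>
    (hk.integrable_truncMonomial i j).const_mul _
  simp only [h1]
  rw [integral_finsetSum _ fun i _ => integrable_finsetSum _ fun j _ => hint i j]
  refine Finset.sum_congr rfl fun i _ => ?_
  rw [integral_finsetSum _ fun j _ => hint i j, Finset.sum_eq_single i]
  · rw [integral_const_mul, hk.integral_truncMonomial_self, mul_one]
  · intro j _ hj
    rw [integral_const_mul, hk.integral_truncMonomial_of_ne hj.symm, mul_zero]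
  · simp

lemma integrableOn_norm_gt (hk : IsNormalizedKernel k) {δ : ℝ} (hδ : 0 < δ) :
    IntegrableOn k {h | δ < ‖h‖} := by
  have hm : MeasurableSet {h : EuclideanSpace ℝ (Fin (n + 1)) | δ < ‖h‖} :=
    measurableSet_lt measurable_const measurable_norm
  have hc : 0 < min 1 (δ ^ 2) := lt_min zero_lt_one (by positivity)
  refine Integrable.mono' ((hk.integrable.const_mul (min 1 (δ ^ 2))⁻¹).integrableOn)
    hk.aemeasurable.aestronglyMeasurable.restrict ?_
  filter_upwards [ae_restrict_mem hm] with h hh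
  have hh : δ < ‖h‖ := hh
  have h0 : h ≠ 0 := norm_pos_iff.1 (hδ.trans hh)
  have hn := hk.nonneg h h0
  rw [Real.norm_eq_abs, abs_of_nonneg hn, inv_mul_eq_div, le_div_iff₀ hc, mul_comm]
  refine mul_le_mul_of_nonneg_right (min_le_min le_rfl ?_) hn
  exact pow_le_pow_left₀ hδ.le hh.le 2

/-- Split at |h| = δ: inside, the bound by η meets the total mass n + 1; outside, |f| ≤ C meets the
tail of k. -/
lemma abs_integral_mul_le (hk : IsNormalizedKernel k)
    {f : EuclideanSpace ℝ (Fin (n + 1)) → ℝ} {C η δ : ℝ}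
    (hη : 0 ≤ η) (hδ : 0 < δ) (hC : ∀ h, |f h| ≤ C * min 1 (‖h‖ ^ 2))
    (hsmall : ∀ h, ‖h‖ ≤ δ → |f h| ≤ η * min 1 (‖h‖ ^ 2)) :
    |∫ h, k h * f h| ≤ η * (n + 1) + C * ∫ h in {h | δ < ‖h‖}, k h := by
  have hm : MeasurableSet {h : EuclideanSpace ℝ (Fin (n + 1)) | δ < ‖h‖} :=
    measurableSet_lt measurable_const measurable_norm
  have hCi : Integrable ({h : EuclideanSpace ℝ (Fin (n + 1)) | δ < ‖h‖}.indicator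
      fun h => C * k h) :=
    (integrable_indicator_iff hm).2 ((hk.integrableOn_norm_gt hδ).const_mul C)
  rw [← hk.integral_eq, ← integral_const_mul, ← integral_const_mul, ← integral_indicator hm,
    ← integral_add (hk.integrable.const_mul η)
      hCi, ← Real.norm_eq_abs]
  refine norm_integral_le_of_norm_le ((hk.integrable.const_mul η).add
    hCi)
    (Eventually.of_forall fun h => ?_)
  by_cases hh : δ < ‖h‖
  · have h0 : h ≠ 0 := norm_pos_iff.1 (hδ.trans hh)
    have hn := hk.nonneg h h0
    have hC0 : 0 ≤ C := by
      by_contra! hneg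
      have h1 := (abs_nonneg _).trans (hC h)
      have h2 : 0 < min 1 (‖h‖ ^ 2) := lt_min zero_lt_one (by positivity)
      nlinarith
    rw [indicator_of_mem (show h ∈ {h | δ < ‖h‖} from hh)]
    have h1 := mul_nonneg hη (hk.min_mul_nonneg h)
    have h2 : |f h| ≤ C := (hC h).trans (mul_le_of_le_one_right hC0 (min_le_left _ _))
    rw [norm_mul, Real.norm_eq_abs, Real.norm_eq_abs, abs_of_nonneg hn]
    have h3 := mul_le_mul_of_nonneg_left h2 hn
    linarith
  · rw [indicator_of_notMem (show h ∉ {h | δ < ‖h‖} from hh), add_zero]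
    rcases eq_or_ne h 0 with rfl | h0
    · have := hC 0
      simp only [norm_zero, ne_eq, OfNat.ofNat_ne_zero, not_false_eq_true, zero_pow, zero_le_one,
        inf_of_le_right, mul_zero, zero_mul] at this ⊢
      rw [abs_nonpos_iff.1 this, mul_zero, norm_zero]
    · have hn := hk.nonneg h h0
      rw [norm_mul, Real.norm_eq_abs, Real.norm_eq_abs, abs_of_nonneg hn]
      have h3 := mul_le_mul_of_nonneg_left (hsmall h (not_lt.1 hh)) hn
      linarith

end IsNormalizedKernel

/-- Concentrating normalized radial kernels act on functions with a quadratic expansion at the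
origin as the trace of the quadratic form. -/
theorem tendsto_integral_kernel_mul {κ : ℝ → EuclideanSpace ℝ (Fin (n + 1)) → ℝ}
    (hκ : ∀ ε ∈ Ioo (0 : ℝ) 1, IsNormalizedKernel (κ ε))
    (hcon : ∀ δ : ℝ, 0 < δ → Tendsto (fun ε => ∫ h in {h | δ < ‖h‖}, κ ε h) (𝓝[>] 0) (𝓝 0))
    {f : EuclideanSpace ℝ (Fin (n + 1)) → ℝ} (hf : AEStronglyMeasurable f) {C : ℝ}
    (hC : ∀ h, |f h| ≤ C * min 1 (‖h‖ ^ 2)) (Q : Fin (n + 1) → Fin (n + 1) → ℝ)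
    (hQ : ∀ η : ℝ, 0 < η → ∃ δ : ℝ, 0 < δ ∧ ∀ h, ‖h‖ ≤ δ →
      |f h - ∑ i, ∑ j, Q i j * (h i * h j)| ≤ η * ‖h‖ ^ 2) :
    Tendsto (fun ε => ∫ h, κ ε h * f h) (𝓝[>] 0) (𝓝 (∑ i, Q i i)) := by
  -- The truncated quadratic form integrates to exactly the trace for every ε, so only f - q has to
  -- be estimated: it is O(min(1, |h|²)) globally and o(|h|²) at 0.
  set q : EuclideanSpace ℝ (Fin (n + 1)) → ℝ := fun h => ∑ i, ∑ j, Q i j * truncMonomial i j h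
    with hq
  have hqm : Measurable q := Finset.measurable_sum _ fun i _ => Finset.measurable_sum _ fun j _ =>
    (measurable_truncMonomial i j).const_mul _
  set D := ∑ i, ∑ j, |Q i j| with hD
  have hqb : ∀ h, |q h| ≤ D * min 1 (‖h‖ ^ 2) := by
    intro h
    rw [hq, hD, Finset.sum_mul]
    refine (Finset.abs_sum_le_sum_abs _ _).trans (Finset.sum_le_sum fun i _ => ?_)
    rw [Finset.sum_mul]
    refine (Finset.abs_sum_le_sum_abs _ _).trans (Finset.sum_le_sum fun j _ => ?_)
    rw [abs_mul]
    exact mul_le_mul_of_nonneg_left ((abs_truncMonomial_le i j h).trans_eq (one_mul _))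
      (abs_nonneg _)
  have hfq : ∀ h, |f h - q h| ≤ (C + D) * min 1 (‖h‖ ^ 2) := fun h =>
    (abs_sub _ _).trans ((add_le_add (hC h) (hqb h)).trans_eq (add_mul _ _ _).symm)
  rw [tendsto_iff_norm_sub_tendsto_zero]
  refine squeeze_zero_norm' (a := fun ε => |∫ h, κ ε h * (f h - q h)|) ?_ ?_
  · filter_upwards [Ioo_mem_nhdsGT (zero_lt_one' ℝ)] with ε hε
    have hk := hκ ε hε
    rw [norm_norm, ← hk.integral_sum_truncMonomial Q, ← integral_sub (hk.integrable_mul hf hC)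
      (hk.integrable_mul hqm.aestronglyMeasurable hqb), Real.norm_eq_abs]
    refine le_of_eq (congrArg _ (integral_congr_ae (Eventually.of_forall fun h => ?_)))
    simp only [hq]
    ring
  · rw [Metric.tendsto_nhds]
    intro η hη
    obtain ⟨δ, hδ, hδQ⟩ := hQ (η / (2 * (n + 1))) (by positivity)
    -- Within radius 1 the truncated monomials are the monomials hᵢhⱼ.
    have hδ' : 0 < min δ 1 := lt_min hδ zero_lt_one
    have hlim := (hcon _ hδ').const_mul (C + D)
    rw [mul_zero] at hlim
    filter_upwards [Ioo_mem_nhdsGT (zero_lt_one' ℝ), hlim.eventually (gt_mem_nhds (half_pos hη))]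
      with ε hε hε2
    have := (hκ ε hε).abs_integral_mul_le (η := η / (2 * (n + 1))) (by positivity) hδ' hfq
      (fun h hh => by
        have hh1 : ‖h‖ ≤ 1 := hh.trans (min_le_right _ _)
        have h2 := hδQ h (hh.trans (min_le_left _ _))
        rw [min_eq_right (pow_le_one₀ (norm_nonneg h) hh1)]
        simpa only [hq, truncMonomial_of_norm_le_one hh1] using h2)
    have h3 : η / (2 * (n + 1)) * (n + 1) = η / 2 := by
      field_simp
    rw [h3] at this
    rw [Real.dist_eq, sub_zero, abs_abs]
    linarith

end Kernels

/-! ### Line integrals along segments. -/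

section LineIntegral

variable {d : ℕ} {G : EuclideanSpace ℝ (Fin d) → EuclideanSpace ℝ (Fin d)}

/-- The line integral of `G` along the segment from `x` to `x + h`. -/
noncomputable def lineIntegral (G : EuclideanSpace ℝ (Fin d) → EuclideanSpace ℝ (Fin d))
    (x h : EuclideanSpace ℝ (Fin d)) : ℝ :=
  ∫ t in (0 : ℝ)..1, inner ℝ (G (x + t • h)) h

lemma continuous_lineIntegral (hG : Continuous G) :
    Continuous fun p : EuclideanSpace ℝ (Fin d) × EuclideanSpace ℝ (Fin d) =>
      lineIntegral G p.1 p.2 := by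
  refine intervalIntegral.continuous_parametric_intervalIntegral_of_continuous'
    (f := fun (p : EuclideanSpace ℝ (Fin d) × EuclideanSpace ℝ (Fin d)) (t : ℝ) =>
      inner ℝ (G (p.1 + t • p.2)) p.2) ?_ 0 1
  unfold Function.uncurry
  fun_prop

lemma lineIntegral_reverse (x h : EuclideanSpace ℝ (Fin d)) :
    lineIntegral G (x + h) (-h) = -lineIntegral G x h := by
  have h1 := intervalIntegral.integral_comp_sub_left (a := 0) (b := 1)
    (fun t : ℝ => inner ℝ (G (x + t • h)) h) 1
  rw [sub_self, sub_zero] at h1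
  rw [lineIntegral, lineIntegral, ← h1, ← intervalIntegral.integral_neg]
  refine intervalIntegral.integral_congr fun t _ => ?_
  simp only [inner_neg_right]
  congr 3
  module

/-- Besides the trivial bound M‖h‖ there is one uniform in h: the segment meets a ball of radius R
containing the support only for parameters in a set of length at most 2R/‖h‖, and the factor ‖h‖
cancels. The proof uses max(R, 0) because R may be negative when the support is empty. -/
lemma exists_abs_lineIntegral_le (hG : Continuous G) (hc : HasCompactSupport G) :
    ∃ C : ℝ, 0 ≤ C ∧ ∀ x h, |lineIntegral G x h| ≤ C * min 1 ‖h‖ := by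
  obtain ⟨M, hM⟩ := hG.bounded_above_of_compact_support hc
  have hM0 : 0 ≤ M := (norm_nonneg _).trans (hM 0)
  obtain ⟨R, hR⟩ := hc.isCompact.isBounded.subset_closedBall 0
  have hin : ∀ x h, ‖inner ℝ (G x) h‖ ≤ M * ‖h‖ := fun x h =>
    (norm_inner_le_norm _ _).trans (mul_le_mul_of_nonneg_right (hM x) (norm_nonneg h))
  have h1 : ∀ x h, |lineIntegral G x h| ≤ M * ‖h‖ := by
    intro x h
    have := intervalIntegral.norm_integral_le_of_norm_le_const (a := (0 : ℝ)) (b := 1)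
      (f := fun t : ℝ => inner ℝ (G (x + t • h)) h) fun t _ => hin (x + t • h) h
    simpa [lineIntegral] using this
  have h2 : ∀ x h, |lineIntegral G x h| ≤ M * (2 * max R 0) := by
    intro x h
    rcases eq_or_ne h 0 with rfl | h0
    · have := h1 x 0
      rw [norm_zero, mul_zero] at this
      exact this.trans (by positivity)
    have hp : 0 < ‖h‖ := norm_pos_iff.2 h0
    set T : Set ℝ := (fun t : ℝ => x + t • h) ⁻¹' Metric.closedBall 0 R with hT
    have hTm : MeasurableSet T := (Metric.isClosed_closedBall.preimage (by fun_prop)).measurableSet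
    have hTd : Metric.ediam T ≤ ENNReal.ofReal (2 * max R 0 / ‖h‖) := by
      refine Metric.ediam_le fun s hs t ht => ?_
      rw [edist_dist]
      refine ENNReal.ofReal_le_ofReal ?_
      rw [le_div_iff₀ hp, Real.dist_eq, ← Real.norm_eq_abs, ← norm_smul]
      have h3 : (s - t) • h = (x + s • h) - (x + t • h) := by module
      rw [h3]
      have hs : ‖x + s • h‖ ≤ R := by simpa [hT] using hs
      have ht : ‖x + t • h‖ ≤ R := by simpa [hT] using ht
      have := norm_sub_le (x + s • h) (x + t • h)
      linarith [le_max_left R 0]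
    have hTv : volume (Ioc 0 1 ∩ T) ≤ ENNReal.ofReal (2 * max R 0 / ‖h‖) :=
      (measure_mono inter_subset_right).trans ((Real.volume_le_diam T).trans hTd)
    have h3 : lineIntegral G x h = ∫ t in Ioc 0 1 ∩ T, inner ℝ (G (x + t • h)) h := by
      rw [lineIntegral, intervalIntegral.integral_of_le zero_le_one]
      have h5 : ∀ t ∈ Ioc (0 : ℝ) 1 \ (Ioc 0 1 ∩ T), inner ℝ (G (x + t • h)) h = 0 := by
        intro t ht
        have h4 : x + t • h ∉ tsupport G := fun hh => ht.2 ⟨ht.1, hR hh⟩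
        rw [image_eq_zero_of_notMem_tsupport h4, inner_zero_left]
      exact setIntegral_eq_of_subset_of_forall_sdiff_eq_zero measurableSet_Ioc
        inter_subset_left h5
    rw [h3, ← Real.norm_eq_abs]
    calc _ ≤ M * ‖h‖ * volume.real (Ioc 0 1 ∩ T) :=
          norm_setIntegral_le_of_norm_le_const (hTv.trans_lt ENNReal.ofReal_lt_top)
            fun t _ => hin _ h
      _ ≤ M * ‖h‖ * (2 * max R 0 / ‖h‖) :=
          mul_le_mul_of_nonneg_left (ENNReal.toReal_le_of_le_ofReal (by positivity) hTv)
            (by positivity)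
      _ = _ := by field_simp
  refine ⟨max M (M * (2 * max R 0)), le_max_of_le_left hM0, fun x h => ?_⟩
  rcases le_total 1 ‖h‖ with hh | hh
  · rw [min_eq_left hh, mul_one]
    exact (h2 x h).trans (le_max_right _ _)
  · rw [min_eq_right hh]
    exact (h1 x h).trans (mul_le_mul_of_nonneg_right (le_max_left _ _) (norm_nonneg h))

/-- Compact support makes DG uniformly continuous, so the mean value inequality is uniform in x. -/
lemma exists_norm_sub_fderiv_le (hG : ContDiff ℝ 1 G) (hc : HasCompactSupport G) {η : ℝ}
    (hη : 0 < η) : ∃ δ : ℝ, 0 < δ ∧ ∀ x v, ‖v‖ ≤ δ →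
      ‖G (x + v) - G x - fderiv ℝ G x v‖ ≤ η * ‖v‖ := by
  have huc : UniformContinuous (fderiv ℝ G) :=
    (hc.fderiv (𝕜 := ℝ)).uniformContinuous_of_continuous (hG.continuous_fderiv one_ne_zero)
  obtain ⟨δ, hδ, hu⟩ := Metric.uniformContinuous_iff.1 huc η hη
  refine ⟨δ / 2, by positivity, fun x v hv => ?_⟩
  have := (convex_closedBall x ‖v‖).norm_image_sub_le_of_norm_fderiv_le' (𝕜 := ℝ) (f := G)
    (φ := fderiv ℝ G x) (C := η) (x := x) (y := x + v)
    (fun y _ => (hG.differentiable one_ne_zero) y) (fun y hy => ?_) (by simp) (by simp)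
  · simpa using this
  · rw [← dist_eq_norm]
    refine (hu ?_).le
    rw [Metric.mem_closedBall] at hy
    linarith

/-- The terms ±⟨G(x), h⟩ cancel. The derivative terms add up to 2t⟨DG(x) h, h⟩, whose integral over
t ∈ [0, 1] is ⟨DG(x) h, h⟩. -/
lemma exists_abs_lineIntegral_add_sub_le (hG : ContDiff ℝ 1 G) (hc : HasCompactSupport G) {η : ℝ}
    (hη : 0 < η) : ∃ δ : ℝ, 0 < δ ∧ ∀ x h, ‖h‖ ≤ δ →
      |lineIntegral G x h + lineIntegral G x (-h) - inner ℝ (fderiv ℝ G x h) h| ≤ η * ‖h‖ ^ 2 := by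
  obtain ⟨δ, hδ, hδG⟩ := exists_norm_sub_fderiv_le hG hc (half_pos hη)
  refine ⟨δ, hδ, fun x h hh => ?_⟩
  have hcont : ∀ v : EuclideanSpace ℝ (Fin d),
      IntervalIntegrable (fun t : ℝ => inner ℝ (G (x + t • v)) v) volume 0 1 := fun v => by
    have := hG.continuous
    exact Continuous.intervalIntegrable (by fun_prop) _ _
  have h2t : inner ℝ (fderiv ℝ G x h) h =
      ∫ t in (0 : ℝ)..1, 2 * t * inner ℝ (fderiv ℝ G x h) h := by
    rw [intervalIntegral.integral_mul_const, intervalIntegral.integral_const_mul, integral_id]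
    norm_num
  rw [h2t, lineIntegral, lineIntegral, ← intervalIntegral.integral_add (hcont h) (hcont (-h)),
    ← intervalIntegral.integral_sub ((hcont h).add (hcont (-h)))
      (Continuous.intervalIntegrable (by fun_prop) _ _), ← Real.norm_eq_abs]
  have key : ∀ t ∈ Set.uIoc (0 : ℝ) 1, ‖inner ℝ (G (x + t • h)) h + inner ℝ (G (x + t • -h)) (-h) -
      2 * t * inner ℝ (fderiv ℝ G x h) h‖ ≤ η * ‖h‖ ^ 2 := by
    intro t ht
    rw [uIoc_of_le zero_le_one] at ht
    have e1 : inner ℝ (G (x + t • h)) h + inner ℝ (G (x + t • -h)) (-h) -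
        2 * t * inner ℝ (fderiv ℝ G x h) h =
        inner ℝ ((G (x + t • h) - G x - fderiv ℝ G x (t • h)) -
          (G (x + t • -h) - G x - fderiv ℝ G x (t • -h))) h := by
      simp only [inner_sub_left, inner_neg_right, map_smul, map_neg, real_inner_smul_left,
        inner_neg_left]
      ring
    have e2 : ‖t • h‖ ≤ ‖h‖ := by
      rw [norm_smul, Real.norm_of_nonneg ht.1.le]
      exact mul_le_of_le_one_left (norm_nonneg h) ht.2
    have e3 : ‖t • -h‖ ≤ ‖h‖ := by rwa [smul_neg, norm_neg]
    have e4 := (hδG x (t • h) (e2.trans hh)).trans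
      (mul_le_mul_of_nonneg_left e2 (half_pos hη).le)
    have e5 := (hδG x (t • -h) (e3.trans hh)).trans
      (mul_le_mul_of_nonneg_left e3 (half_pos hη).le)
    rw [e1]
    calc _ ≤ _ := norm_inner_le_norm _ _
      _ ≤ (η * ‖h‖) * ‖h‖ := by
          refine mul_le_mul_of_nonneg_right ((norm_sub_le _ _).trans ?_) (norm_nonneg h)
          linarith
      _ = _ := by ring
  have := intervalIntegral.norm_integral_le_of_norm_le_const key
  simpa using this

end LineIntegral

/-! ### The nonlocal normal term as an integral of fluxes. -/

section NonlocalFlux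

variable {n : ℕ} {Ω : Set (EuclideanSpace ℝ (Fin (n + 1)))}
  {G : EuclideanSpace ℝ (Fin (n + 1)) → EuclideanSpace ℝ (Fin (n + 1))}
  {k : EuclideanSpace ℝ (Fin (n + 1)) → ℝ}

/-- The flux of `G` along the translates by `h` of points of `Ω` that leave `Ω`. -/
noncomputable def exitFlux (Ω : Set (EuclideanSpace ℝ (Fin (n + 1))))
    (G : EuclideanSpace ℝ (Fin (n + 1)) → EuclideanSpace ℝ (Fin (n + 1)))
    (h : EuclideanSpace ℝ (Fin (n + 1))) : ℝ :=
  ∫ w in {w | w ∈ Ω ∧ w + h ∉ Ω}, lineIntegral G w h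

lemma measurableSet_exit (hΩ : MeasurableSet Ω) (h : EuclideanSpace ℝ (Fin (n + 1))) :
    MeasurableSet {w | w ∈ Ω ∧ w + h ∉ Ω} :=
  hΩ.inter ((measurable_add_const h) hΩ.compl)

lemma integrableOn_lineIntegral (hG : Continuous G) (hc : HasCompactSupport G)
    {s : Set (EuclideanSpace ℝ (Fin (n + 1)))} (hs : volume s ≠ ⊤)
    (h : EuclideanSpace ℝ (Fin (n + 1))) :
    IntegrableOn (fun w => lineIntegral G w h) s := by
  obtain ⟨C, -, hC⟩ := exists_abs_lineIntegral_le hG hc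
  exact Measure.integrableOn_of_bounded hs
    ((continuous_lineIntegral hG).comp (by fun_prop : Continuous fun w => (w, h))).aestronglyMeasurable
    (M := C * min 1 ‖h‖) (Eventually.of_forall fun w => hC w h)

/-- The line integral and the volume of the exit set are each O(min(1, |h|)); the product matches
the weight in (L1). -/
lemma IsBoundedC1Domain.exists_integral_abs_lineIntegral_le (hΩ : IsBoundedC1Domain Ω)
    (hG : Continuous G) (hc : HasCompactSupport G) :
    ∃ C : ℝ, 0 ≤ C ∧ ∀ h, ∫ w in {w | w ∈ Ω ∧ w + h ∉ Ω}, |lineIntegral G w h| ≤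
      C * min 1 (‖h‖ ^ 2) := by
  obtain ⟨C, hC0, hC⟩ := exists_abs_lineIntegral_le hG hc
  obtain ⟨D, hD0, hD⟩ := hΩ.exists_volume_le
  have hvol : volume Ω ≠ ⊤ := hΩ.2.2.1.measure_lt_top.ne
  set D' := max D (volume Ω).toReal with hD'
  have hD'0 : 0 ≤ D' := le_max_of_le_left hD0
  refine ⟨C * D', by positivity, fun h => ?_⟩
  set s := {w | w ∈ Ω ∧ w + h ∉ Ω} with hs
  have hsΩ : volume s ≤ volume Ω := measure_mono fun w hw => hw.1
  have hm0 : 0 ≤ min 1 ‖h‖ := le_min zero_le_one (norm_nonneg h)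
  have h1 : volume.real s ≤ D' * min 1 ‖h‖ := by
    rcases le_total 1 ‖h‖ with hh | hh
    · rw [min_eq_left hh, mul_one]
      exact (ENNReal.toReal_mono hvol hsΩ).trans (le_max_right _ _)
    · rw [min_eq_right hh]
      exact (ENNReal.toReal_le_of_le_ofReal (by positivity) (hD h)).trans
        (mul_le_mul_of_nonneg_right (le_max_left _ _) (norm_nonneg h))
  have h2 := norm_setIntegral_le_of_norm_le_const (μ := volume) (s := s)
    (f := fun w => |lineIntegral G w h|) (C := C * min 1 ‖h‖) (hsΩ.trans_lt hvol.lt_top)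
    fun w _ => by rw [Real.norm_eq_abs, abs_abs]; exact hC w h
  have h3 : min 1 ‖h‖ * min 1 ‖h‖ = min 1 (‖h‖ ^ 2) := by
    rcases le_total 1 ‖h‖ with hh | hh
    · rw [min_eq_left hh, min_eq_left (one_le_pow₀ hh), mul_one]
    · rw [min_eq_right hh, min_eq_right (pow_le_one₀ (norm_nonneg h) hh), sq]
  calc _ ≤ C * min 1 ‖h‖ * volume.real s := (le_abs_self _).trans h2
    _ ≤ C * min 1 ‖h‖ * (D' * min 1 ‖h‖) := mul_le_mul_of_nonneg_left h1 (by positivity)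
    _ = _ := by rw [← h3]; ring

/-- Segments that end in Ω cancel: translation by h maps the starting points staying in Ω under h
onto those staying under -h, and reverses the segments. -/
lemma exitFlux_add_exitFlux_neg (hΩ : IsBoundedC1Domain Ω) (hG : Continuous G)
    (hc : HasCompactSupport G) (h : EuclideanSpace ℝ (Fin (n + 1))) :
    exitFlux Ω G h + exitFlux Ω G (-h) =
      ∫ w in Ω, (lineIntegral G w h + lineIntegral G w (-h)) := by
  have hm := hΩ.1.measurableSet
  have hvol : volume Ω ≠ ⊤ := hΩ.2.2.1.measure_lt_top.ne
  have hsplit : ∀ v, ∫ w in Ω, lineIntegral G w v =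
      exitFlux Ω G v + ∫ w in {w | w ∈ Ω ∧ w + v ∈ Ω}, lineIntegral G w v := by
    intro v
    have h1 : Ω = {w | w ∈ Ω ∧ w + v ∉ Ω} ∪ {w | w ∈ Ω ∧ w + v ∈ Ω} := by
      ext w
      by_cases hw : w + v ∈ Ω <;> simp [hw]
    have hm2 : MeasurableSet {w | w ∈ Ω ∧ w + v ∈ Ω} := hm.inter ((measurable_add_const v) hm)
    conv_lhs => rw [h1]
    rw [exitFlux]
    refine setIntegral_union ?_ hm2 ?_ ?_
    · exact disjoint_left.2 fun w hw hw' => hw.2 hw'.2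
    · exact (integrableOn_lineIntegral hG hc hvol v).mono_set fun w hw => hw.1
    · exact (integrableOn_lineIntegral hG hc hvol v).mono_set fun w hw => hw.1
  have hodd : ∫ w in {w | w ∈ Ω ∧ w + -h ∈ Ω}, lineIntegral G w (-h) =
      -∫ w in {w | w ∈ Ω ∧ w + h ∈ Ω}, lineIntegral G w h := by
    have h1 := (measurePreserving_add_right volume h).setIntegral_preimage_emb
      (measurableEmbedding_addRight h) (fun w => lineIntegral G w (-h))
      {w | w ∈ Ω ∧ w + -h ∈ Ω}
    rw [← h1, ← integral_neg]
    have h2 : (fun x => x + h) ⁻¹' {w | w ∈ Ω ∧ w + -h ∈ Ω} = {w | w ∈ Ω ∧ w + h ∈ Ω} := by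
      ext w
      simp [and_comm]
    rw [h2]
    exact integral_congr_ae (Eventually.of_forall fun w => lineIntegral_reverse w h)
  rw [integral_add (integrableOn_lineIntegral hG hc hvol h)
    (integrableOn_lineIntegral hG hc hvol (-h)), hsplit h, hsplit (-h), hodd]
  ring

/-- The integrand of the double integral of the nonlocal normal operator, in the variables
`(w, h)` with `w ∈ Ω` and `w + h ∉ Ω`. -/
noncomputable def exitIntegrand (Ω : Set (EuclideanSpace ℝ (Fin (n + 1))))
    (G : EuclideanSpace ℝ (Fin (n + 1)) → EuclideanSpace ℝ (Fin (n + 1)))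
    (k : EuclideanSpace ℝ (Fin (n + 1)) → ℝ)
    (p : EuclideanSpace ℝ (Fin (n + 1)) × EuclideanSpace ℝ (Fin (n + 1))) : ℝ :=
  k p.2 * {w | w ∈ Ω ∧ w + p.2 ∉ Ω}.indicator (fun w => lineIntegral G w p.2) p.1

lemma integral_exitIntegrand (hΩ : MeasurableSet Ω) (h : EuclideanSpace ℝ (Fin (n + 1))) :
    ∫ w, exitIntegrand Ω G k (w, h) = k h * exitFlux Ω G h := by
  simp only [exitIntegrand]
  rw [integral_const_mul, integral_indicator (measurableSet_exit hΩ h), exitFlux]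

lemma stronglyMeasurable_exit (hΩ : MeasurableSet Ω) (hG : Continuous G) :
    StronglyMeasurable fun p : EuclideanSpace ℝ (Fin (n + 1)) × EuclideanSpace ℝ (Fin (n + 1)) =>
      {w | w ∈ Ω ∧ w + p.2 ∉ Ω}.indicator (fun w => lineIntegral G w p.2) p.1 := by
  have hm : MeasurableSet {p : EuclideanSpace ℝ (Fin (n + 1)) × EuclideanSpace ℝ (Fin (n + 1)) |
      p.1 ∈ Ω ∧ p.1 + p.2 ∉ Ω} :=
    (measurable_fst hΩ).inter ((measurable_fst.add measurable_snd) hΩ.compl)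
  exact (continuous_lineIntegral hG).stronglyMeasurable.indicator hm

lemma measurable_exitFlux (hΩ : MeasurableSet Ω) (hG : Continuous G) :
    Measurable (exitFlux Ω G) := by
  have h1 := (stronglyMeasurable_exit hΩ hG).integral_prod_left' (μ := volume)
  have h2 : exitFlux Ω G = fun h => ∫ w, {w | w ∈ Ω ∧ w + h ∉ Ω}.indicator
      (fun w => lineIntegral G w h) w := by
    funext h
    rw [integral_indicator (measurableSet_exit hΩ h), exitFlux]
  rw [h2]
  exact h1.measurable

lemma abs_exitFlux_le {C : ℝ}
    (hC : ∀ h, ∫ w in {w | w ∈ Ω ∧ w + h ∉ Ω}, |lineIntegral G w h| ≤ C * min 1 (‖h‖ ^ 2))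
    (h : EuclideanSpace ℝ (Fin (n + 1))) : |exitFlux Ω G h| ≤ C * min 1 (‖h‖ ^ 2) :=
  (norm_integral_le_integral_norm (fun w => lineIntegral G w h)).trans (hC h)

/-- Tonelli with w integrated first: the inner integral of the norm is at most C min(1, |h|²) k(h).
-/
lemma integrable_exitIntegrand (hΩ : IsBoundedC1Domain Ω) (hG : Continuous G)
    (hc : HasCompactSupport G) (hk : IsNormalizedKernel k) :
    Integrable (exitIntegrand Ω G k) (volume.prod volume) := by
  have hm := hΩ.1.measurableSet
  have hvol : volume Ω ≠ ⊤ := hΩ.2.2.1.measure_lt_top.ne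
  obtain ⟨C, hC0, hC⟩ := hΩ.exists_integral_abs_lineIntegral_le hG hc
  have hmeas : AEStronglyMeasurable (exitIntegrand Ω G k) (volume.prod volume) :=
    (hk.aemeasurable.aestronglyMeasurable.comp_snd).mul
      (stronglyMeasurable_exit hm hG).aestronglyMeasurable
  have hind : ∀ h, Integrable
      ({w | w ∈ Ω ∧ w + h ∉ Ω}.indicator fun w => lineIntegral G w h) := fun h =>
    (integrable_indicator_iff (measurableSet_exit hm h)).2
      ((integrableOn_lineIntegral hG hc hvol h).mono_set fun w hw => hw.1)
  rw [integrable_prod_iff' hmeas]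
  refine ⟨Eventually.of_forall fun h => (hind h).const_mul (k h), ?_⟩
  have hval : ∀ h, ∫ w, ‖exitIntegrand Ω G k (w, h)‖ =
      ‖k h * ∫ w in {w | w ∈ Ω ∧ w + h ∉ Ω}, |lineIntegral G w h|‖ := by
    intro h
    simp only [exitIntegrand, norm_mul, norm_indicator_eq_indicator_norm]
    rw [integral_const_mul, integral_indicator (measurableSet_exit hm h)]
    congr 1
    exact (Real.norm_of_nonneg (integral_nonneg fun _ => abs_nonneg _)).symm
  refine Integrable.mono' (hk.integrable.const_mul C) hmeas.norm.prod_swap.integral_prod_right'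
    (Eventually.of_forall fun h => ?_)
  rw [hval, norm_norm]
  refine hk.abs_mul_le (f := fun h => ∫ w in {w | w ∈ Ω ∧ w + h ∉ Ω}, |lineIntegral G w h|)
    (fun h => ?_) h
  rw [abs_of_nonneg (integral_nonneg fun _ => abs_nonneg _)]
  exact hC h

/-- The factor 2 of the normal operator becomes a symmetrisation in h because k is even. -/
lemma integral_exitIntegrand_prod (hΩ : IsBoundedC1Domain Ω) (hG : Continuous G)
    (hc : HasCompactSupport G) (hk : IsNormalizedKernel k) :
    2 * ∫ p, exitIntegrand Ω G k p ∂(volume.prod volume) =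
      ∫ h, k h * (exitFlux Ω G h + exitFlux Ω G (-h)) := by
  have hm := hΩ.1.measurableSet
  obtain ⟨C, -, hC⟩ := hΩ.exists_integral_abs_lineIntegral_le hG hc
  have hi : Integrable fun h => k h * exitFlux Ω G h :=
    hk.integrable_mul (measurable_exitFlux hm hG).aestronglyMeasurable (abs_exitFlux_le hC)
  have heven : ∀ h, k (-h) = k h := fun h => hk.apply_isometry (LinearIsometryEquiv.neg ℝ) h
  have hi' : Integrable fun h => k h * exitFlux Ω G (-h) := by
    have := hi.comp_neg
    simpa only [heven] using this
  have hneg : ∫ h, k h * exitFlux Ω G (-h) = ∫ h, k h * exitFlux Ω G h := by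
    have := integral_neg_eq_self (fun h => k h * exitFlux Ω G h) volume
    simpa only [heven] using this
  rw [integral_prod_symm _ (integrable_exitIntegrand hΩ hG hc hk)]
  simp only [integral_exitIntegrand hm, mul_add]
  rw [integral_add hi hi', hneg]
  ring

/-- The integrand of the double integral of the nonlocal normal operator. -/
noncomputable def normalIntegrand (Ω : Set (EuclideanSpace ℝ (Fin (n + 1))))
    (G : EuclideanSpace ℝ (Fin (n + 1)) → EuclideanSpace ℝ (Fin (n + 1)))
    (α μ : EuclideanSpace ℝ (Fin (n + 1)) → ℝ)
    (p : EuclideanSpace ℝ (Fin (n + 1)) × EuclideanSpace ℝ (Fin (n + 1))) : ℝ :=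
  Ωᶜ.indicator (fun x => Ω.indicator (fun y => nonlocalField α G x y * μ (y - x)) p.2) p.1

variable {α μ : EuclideanSpace ℝ (Fin (n + 1)) → ℝ}

/-- The change of variables x = w + h, y = w. The minus sign comes from traversing the segment
backwards, and cancels that of -2 in the normal operator. -/
lemma normalIntegrand_add (hμ : IsRadialKernel μ)
    (w h : EuclideanSpace ℝ (Fin (n + 1))) :
    normalIntegrand Ω G α μ (w + h, w) = -exitIntegrand Ω G (fun h => α h * μ h) (w, h) := by
  by_cases hw : w ∈ Ω ∧ w + h ∉ Ω
  · rw [normalIntegrand, exitIntegrand, indicator_of_mem (show w + h ∈ Ωᶜ from hw.2),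
      indicator_of_mem hw.1, indicator_of_mem (show w ∈ {w | w ∈ Ω ∧ w + h ∉ Ω} from hw)]
    have h1 : w - (w + h) = -h := by abel
    have h2 : μ (-h) = μ h := hμ.apply_isometry (LinearIsometryEquiv.neg ℝ) h
    have h3 := lineIntegral_reverse (G := G) w h
    rw [lineIntegral] at h3
    rw [nonlocalField, h1, h3, h2, add_sub_cancel_left]
    ring
  · rw [exitIntegrand, indicator_of_notMem (show w ∉ {w | w ∈ Ω ∧ w + h ∉ Ω} from hw), mul_zero,
      neg_zero, normalIntegrand]
    by_cases h1 : w + h ∈ Ω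
    · exact indicator_of_notMem (not_not.2 h1) _
    · have h2 : w ∉ Ω := fun hh => hw ⟨hh, h1⟩
      simp [h2]

lemma measurePreserving_add_swap :
    MeasurePreserving (fun p : EuclideanSpace ℝ (Fin (n + 1)) × EuclideanSpace ℝ (Fin (n + 1)) =>
      (p.1 + p.2, p.1)) (volume.prod volume) (volume.prod volume) :=
  Measure.measurePreserving_swap.comp (measurePreserving_prod_add volume volume)

lemma measurableEmbedding_add_swap :
    MeasurableEmbedding (fun p : EuclideanSpace ℝ (Fin (n + 1)) × EuclideanSpace ℝ (Fin (n + 1)) =>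
      (p.1 + p.2, p.1)) :=
  ((MeasurableEquiv.shearAddRight (EuclideanSpace ℝ (Fin (n + 1)))).trans
    MeasurableEquiv.prodComm).measurableEmbedding

lemma integrable_normalIntegrand (hΩ : IsBoundedC1Domain Ω) (hG : Continuous G)
    (hc : HasCompactSupport G) (hμ : IsRadialKernel μ)
    (hk : IsNormalizedKernel fun h => α h * μ h) :
    Integrable (normalIntegrand Ω G α μ) (volume.prod volume) := by
  rw [← measurePreserving_add_swap.integrable_comp_emb measurableEmbedding_add_swap]
  refine (integrable_exitIntegrand hΩ hG hc hk).neg.congr (Eventually.of_forall fun p => ?_)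
  exact (normalIntegrand_add hμ p.1 p.2).symm

lemma integral_normalIntegrand (hμ : IsRadialKernel μ) :
    ∫ p, normalIntegrand Ω G α μ p ∂(volume.prod volume) =
      -∫ p, exitIntegrand Ω G (fun h => α h * μ h) p ∂(volume.prod volume) := by
  rw [← measurePreserving_add_swap.integral_comp measurableEmbedding_add_swap, ← integral_neg]
  exact integral_congr_ae (Eventually.of_forall fun p => normalIntegrand_add hμ p.1 p.2)

lemma integral_normalIntegrand_eq_indicator (hΩ : MeasurableSet Ω)
    (x : EuclideanSpace ℝ (Fin (n + 1))) :
    -2 * ∫ y, normalIntegrand Ω G α μ (x, y) =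
      Ωᶜ.indicator (nonlocalNormal μ Ω (nonlocalField α G)) x := by
  by_cases hx : x ∈ Ω
  · simp [normalIntegrand, hx]
  · have hx : x ∈ Ωᶜ := hx
    simp only [normalIntegrand, indicator_of_mem hx]
    rw [integral_indicator hΩ, nonlocalNormal]

/-- Absolute convergence of the integrals that define the nonlocal normal operator. -/
theorem nonlocalNormal_integrable (hΩ : IsBoundedC1Domain Ω) (hG : Continuous G)
    (hc : HasCompactSupport G) (hμ : IsRadialKernel μ)
    (hk : IsNormalizedKernel fun h => α h * μ h) :
    (∀ᵐ x ∂(volume.restrict Ωᶜ),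
        IntegrableOn (fun y => nonlocalField α G x y * μ (y - x)) Ω) ∧
      IntegrableOn (nonlocalNormal μ Ω (nonlocalField α G)) Ωᶜ := by
  have hm := hΩ.1.measurableSet
  have hi := integrable_normalIntegrand hΩ hG hc hμ hk
  constructor
  · rw [ae_restrict_iff' hm.compl]
    filter_upwards [hi.prod_right_ae] with x hx hxΩ
    rw [← integrable_indicator_iff hm]
    refine hx.congr (Eventually.of_forall fun y => ?_)
    simp only [normalIntegrand, indicator_of_mem hxΩ]
  · rw [← integrable_indicator_iff hm.compl]
    exact (hi.integral_prod_left.const_mul (-2)).congr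
      (Eventually.of_forall fun x => integral_normalIntegrand_eq_indicator hm x)

theorem integral_nonlocalNormal (hΩ : IsBoundedC1Domain Ω) (hG : Continuous G)
    (hc : HasCompactSupport G) (hμ : IsRadialKernel μ)
    (hk : IsNormalizedKernel fun h => α h * μ h) :
    ∫ x in Ωᶜ, nonlocalNormal μ Ω (nonlocalField α G) x =
      ∫ h, α h * μ h * (exitFlux Ω G h + exitFlux Ω G (-h)) := by
  have hm := hΩ.1.measurableSet
  rw [← integral_exitIntegrand_prod hΩ hG hc hk, ← integral_indicator hm.compl]
  simp only [← integral_normalIntegrand_eq_indicator hm]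
  rw [integral_const_mul, ← integral_prod _ (integrable_normalIntegrand hΩ hG hc hμ hk),
    integral_normalIntegrand hμ]
  ring

/-- The pointwise expansion of L(w, h) + L(w, -h) is uniform in w, so it integrates over the finite
volume of Ω. -/
lemma exitFlux_expansion (hΩ : IsBoundedC1Domain Ω) (hG : ContDiff ℝ 1 G)
    (hc : HasCompactSupport G) {η : ℝ} (hη : 0 < η) : ∃ δ : ℝ, 0 < δ ∧ ∀ h, ‖h‖ ≤ δ →
      |exitFlux Ω G h + exitFlux Ω G (-h) - ∑ i, ∑ j,
        (∫ w in Ω, fderiv ℝ G w (EuclideanSpace.single i 1) j) * (h i * h j)| ≤ η * ‖h‖ ^ 2 := by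
  have hvol : volume Ω ≠ ⊤ := hΩ.2.2.1.measure_lt_top.ne
  obtain ⟨δ, hδ, hδG⟩ := exists_abs_lineIntegral_add_sub_le hG hc
    (η := η / ((volume Ω).toReal + 1)) (by positivity)
  refine ⟨δ, hδ, fun h hh => ?_⟩
  have hint : ∀ i j : Fin (n + 1),
      IntegrableOn (fun w => fderiv ℝ G w (EuclideanSpace.single i 1) j) Ω := by
    intro i j
    have h1 : Continuous fun w => fderiv ℝ G w (EuclideanSpace.single i 1) j :=
      (EuclideanSpace.proj (𝕜 := ℝ) j).continuous.comp
        ((hG.continuous_fderiv one_ne_zero).clm_apply continuous_const)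
    exact (h1.integrable_of_hasCompactSupport ((hc.fderiv_apply (𝕜 := ℝ) _).comp_left
      (g := fun x : EuclideanSpace ℝ (Fin (n + 1)) => x j) (by simp))).integrableOn
  have hexp : ∀ w, ∑ i, ∑ j, fderiv ℝ G w (EuclideanSpace.single i 1) j * (h i * h j) =
      inner ℝ (fderiv ℝ G w h) h := by
    intro w
    have hh : h = ∑ i, h i • EuclideanSpace.single i (1 : ℝ) := by
      simpa using ((EuclideanSpace.basisFun (Fin (n + 1)) ℝ).sum_repr h).symm
    conv_rhs => rw [hh, map_sum, ← hh, sum_inner]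
    refine Finset.sum_congr rfl fun i _ => ?_
    rw [map_smul, real_inner_smul_left, PiLp.inner_apply, Finset.mul_sum]
    refine Finset.sum_congr rfl fun j _ => ?_
    simp
    ring
  have hsum : ∑ i, ∑ j, (∫ w in Ω, fderiv ℝ G w (EuclideanSpace.single i 1) j) * (h i * h j) =
      ∫ w in Ω, inner ℝ (fderiv ℝ G w h) h := by
    simp only [← hexp, ← integral_mul_const]
    rw [integral_finsetSum _ fun i _ => integrable_finsetSum _ fun j _ => (hint i j).mul_const _]
    refine Finset.sum_congr rfl fun i _ => ?_
    rw [integral_finsetSum _ fun j _ => (hint i j).mul_const _]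
  have hinti : IntegrableOn (fun w => inner ℝ (fderiv ℝ G w h) h) Ω := by
    simp only [← hexp]
    exact integrable_finsetSum _ fun i _ => integrable_finsetSum _ fun j _ =>
      (hint i j).mul_const _
  have hintl : IntegrableOn (fun w => lineIntegral G w h + lineIntegral G w (-h)) Ω :=
    (integrableOn_lineIntegral hG.continuous hc hvol h).add
      (integrableOn_lineIntegral hG.continuous hc hvol (-h))
  rw [hsum, exitFlux_add_exitFlux_neg hΩ hG.continuous hc, ← integral_sub hintl hinti, ← Real.norm_eq_abs]
  refine (norm_setIntegral_le_of_norm_le_const hvol.lt_top fun w _ => hδG w h hh).trans ?_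
  have h1 : η / ((volume Ω).toReal + 1) * (volume Ω).toReal ≤ η := by
    rw [div_mul_eq_mul_div, div_le_iff₀ (by positivity)]
    nlinarith [ENNReal.toReal_nonneg (a := volume Ω)]
  calc _ = η / ((volume Ω).toReal + 1) * (volume Ω).toReal * ‖h‖ ^ 2 := by
        rw [measureReal_def]; ring
    _ ≤ _ := mul_le_mul_of_nonneg_right h1 (by positivity)

end NonlocalFlux

/-! ### The theorem. -/

lemma IsRadialLevyFamily.isNormalizedKernel {n : ℕ}
    {α μ : ℝ → EuclideanSpace ℝ (Fin (n + 1)) → ℝ} (h : IsRadialLevyFamily α μ) {ε : ℝ}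
    (hε : ε ∈ Ioo (0 : ℝ) 1) : IsNormalizedKernel fun h => α ε h * μ ε h where
  toIsRadialKernel := (h.kernel_left ε hε).mul (h.kernel_right ε hε)
  integral_eq := by simpa using h.normalized ε hε

theorem mainTheorem5 {n : ℕ} (Ω : Set (EuclideanSpace ℝ (Fin (n + 1))))
    (hΩ : IsBoundedC1Domain Ω)
    (α μ : ℝ → EuclideanSpace ℝ (Fin (n + 1)) → ℝ) (hαμ : IsRadialLevyFamily α μ)
    -- the vector field `F ∈ C¹(closure Ω)` ...
    (F : EuclideanSpace ℝ (Fin (n + 1)) → EuclideanSpace ℝ (Fin (n + 1)))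
    (hF : ContDiffOn ℝ 1 F (closure Ω))
    -- ... and any compactly supported `C¹` extension `G` of it to the whole space
    (G : EuclideanSpace ℝ (Fin (n + 1)) → EuclideanSpace ℝ (Fin (n + 1)))
    (hG : ContDiff ℝ 1 G) (hGc : HasCompactSupport G) (hGF : EqOn G F (closure Ω)) :
    -- all integrals converge absolutely
    (∀ ε ∈ Ioo (0 : ℝ) 1,
      (∀ᵐ x ∂(volume.restrict Ωᶜ),
        IntegrableOn (fun y => nonlocalField (α ε) G x y * μ ε (y - x)) Ω) ∧
      IntegrableOn (nonlocalNormal (μ ε) Ω (nonlocalField (α ε) G)) Ωᶜ) ∧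
    IntegrableOn (fun x => inner ℝ (F x) (outwardNormal Ω x)) (frontier Ω)
      (Measure.euclideanHausdorffMeasure n) ∧
    -- and the nonlocal normal terms converge to the surface integral
    Tendsto (fun ε => ∫ x in Ωᶜ, nonlocalNormal (μ ε) Ω (nonlocalField (α ε) G) x) (𝓝[>] 0)
      (𝓝 (∫ x in frontier Ω, inner ℝ (F x) (outwardNormal Ω x)
        ∂(Measure.euclideanHausdorffMeasure n))) := by
  refine ⟨fun ε hε => nonlocalNormal_integrable hΩ hG.continuous hGc
    (hαμ.kernel_right ε hε) (hαμ.isNormalizedKernel hε), ?_⟩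
  have hdiv := hΩ.sum_setIntegral_fderiv hG hGc
  have hFG : EqOn (fun x => inner ℝ (G x) (outwardNormal Ω x))
      (fun x => inner ℝ (F x) (outwardNormal Ω x)) (frontier Ω) := fun x hx => by
    simp only [hGF (frontier_subset_closure hx)]
  refine ⟨(integrableOn_congr_fun hFG isClosed_frontier.measurableSet).1 hdiv.1, ?_⟩
  -- The limit takes the form of the trace of the matrix ∫_Ω ∂ᵢGⱼ.
  rw [← setIntegral_congr_fun isClosed_frontier.measurableSet hFG, ← hdiv.2]
  obtain ⟨C, -, hC⟩ := hΩ.exists_integral_abs_lineIntegral_le hG.continuous hGc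
  have hmeas := measurable_exitFlux hΩ.1.measurableSet hG.continuous
  refine (tendsto_integral_kernel_mul (fun ε hε => hαμ.isNormalizedKernel hε) hαμ.concentrates
    (f := fun h => exitFlux Ω G h + exitFlux Ω G (-h)) (C := C + C)
    (hmeas.add (hmeas.comp measurable_neg)).aestronglyMeasurable (fun h => ?_)
    (fun i j => ∫ w in Ω, fderiv ℝ G w (EuclideanSpace.single i 1) j)
    (fun η hη => exitFlux_expansion hΩ hG hGc hη)).congr' ?_
  · have h1 := abs_exitFlux_le hC h
    have h2 := abs_exitFlux_le hC (-h)
    rw [norm_neg] at h2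
    rw [add_mul]
    exact (abs_add_le _ _).trans (add_le_add h1 h2)
  · filter_upwards [Ioo_mem_nhdsGT (zero_lt_one' ℝ)] with ε hε
    exact (integral_nonlocalNormal hΩ hG.continuous hGc
      (hαμ.kernel_right ε hε) (hαμ.isNormalizedKernel hε)).symm
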